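/- **Theorem (PSDP with signed rewards).** There is an absolute constant $c>0$ with the following property. *Setting.* Let $H,d\in\mathbb N$, let $\mathcal A$ be a finite non-empty action set with $A=|\mathcal A|$, and let $\mathcal X=\mathcal X_1\sqcup\dots\sqcup\mathcal X_H$ be a layered measurable state space with a $\sigma$-finite base measure $\nu$. Consider a low-rank MDP: $\boldsymbol x_1\sim\rho\in\Delta(\mathcal X_1)$ and, for $1\le t<H$, $\boldsymbol x_{t+1}\sim T_t(\cdot\mid \boldsymbol x_t,\boldsymbol a_t)$, where $T_t(\cdot\mid x,a)$ is a probability measure on $\mathcal X_{t+1}$ with the everywhere non-negative $\nu$-density $y\mapsto\mu^\star_{t+1}(y)^\top\phi^\star_t(x,a)$, with measurable $\phi^\star_t:\mathcal X_t\times\mathcal A\to\mathbb R^d$ and $\mu^\star_t:\mathcal X_t\to\mathbb R^d$. Assume for all $t\in[H]$ that $\|\phi^\star_t\|\le1$, that $\mu_t^\star$ is $\nu$-integrable on $\mathcal X_t$, and that $\|\int_{\mathcal X_t}\mu^\star_t\,g\,d\nu\|\le\sqrt d$ for all measurable $g:\mathcal X_t\to[0,1]$. Let $\Pi_{\mathtt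 M}$ be the set of randomized Markov policies $\pi:\mathcal X\to\Delta(\mathcal A)$, $\mathbb E^\pi$ the expectation under $\pi$, and $d^\pi(x)$ for $x\in\mathcal X_t$ the density of the law of $\boldsymbol x_t$ under $\pi$ with respect to $\nu$; for $t\ge2$ it is taken in the version $d^\pi(x)=\mu_t^\star(x)^\top\mathbb E^\pi[\phi^\star_{t-1}(\boldsymbol x_{t-1},\boldsymbol a_{t-1})]$. A distribution $P$ over $\Pi_{\mathtt M}$ is an $(\alpha,\varepsilon)$-randomized policy cover for layer $t$ if $\mathbb E_{\pi\sim P}[d^\pi(x)]\ge\alpha\sup_{\pi'\in\Pi_{\mathtt M}}d^{\pi'}(x)$ for all $x\in\mathcal X_t$ with $\sup_{\pi'\in\Pi_{\mathtt M}}d^{\pi'}(x)\ge\varepsilon\|\mu^\star_t(x)\|$. *Hypotheses.* Let $\alpha,\delta,\varepsilon\in(0,1)$, $B\ge1$, $B_1,\dots,B_h>0$, $h\in[H]$, and let $n\ge1$ be an integer with $n\ge2\delta$. Let $r_t:\mathcal X_t\times\mathcal A\to[-B_t,B_t]$, $t\in[h]$, be measurable, let $\mathcal G_t$, $t\in[h]$,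 be classes of measurable functions $\mathcal X_t\times\mathcal A\to\mathbb R$, and let $P^{(1)},\dots,P^{(h)}$ be distributions over $\Pi_{\mathtt M}$ such that 1. $\mathcal G_{1:h}$ realizes $r_{1:h}$: for all $t\in[h]$ and $\pi\in\Pi_{\mathtt M}$ the function $Q^\pi_t(x,a)=r_t(x,a)+\mathbb E^\pi[\sum_{\ell=t+1}^h r_\ell(\boldsymbol x_\ell,\boldsymbol a_\ell)\mid\boldsymbol x_t=x,\boldsymbol a_t=a]$ belongs to $\mathcal G_t$; 2. the functions in $\mathcal G_{1:h}$ and the regression targets are bounded by $B$: $|g|\le B$ for all $g\in\mathcal G_t$, $t\in[h]$, and, for every $t\in[h]$, $\pi\in\Pi_{\mathtt M}$ and $(x,a)\in\mathcal X_t\times\mathcal A$, $|\sum_{\ell=t}^h r_\ell(\boldsymbol x_\ell,\boldsymbol a_\ell)|\le B$ almost surely under $\pi$ started in layer $t$ from $(\boldsymbol x_t,\boldsymbol a_t)=(x,a)$ (which holds, for instance, if $\sum_{t=1}^hB_t\le B$); 3. for each $t\in[h]$, $P^{(t)}$ is an $(\alpha,\varepsilon)$-randomized policy cover for layer $t$.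 *Algorithm.* $\mathtt{PSDP}(h,r_{1:h},\mathcal G_{1:h},P^{(1:h)},n)$ proceeds for $t=h,\dots,1$ as follows. It draws $n$ independent samples $(x,a,R)$ of $(\boldsymbol x_t,\boldsymbol a_t,\sum_{\ell=t}^hr_\ell(\boldsymbol x_\ell,\boldsymbol a_\ell))$, for each of them drawing $\pi\sim P^{(t)}$ and playing $\pi$ in the layers before $t$, a uniformly random action in layer $t$, and $\hat\pi$ (as already determined) in the layers $t+1,\dots,h$; it picks $\hat g^{(t)}\in\operatorname{argmin}_{g\in\mathcal G_t}\sum_{(x,a,R)}(g(x,a)-R)^2$ and sets $\hat\pi(x)\in\operatorname{argmax}_{a\in\mathcal A}\hat g^{(t)}(x,a)$ for $x\in\mathcal X_t$, with any (measurable) choice among minimizers and maximizers. It returns $\hat\pi$. *Conclusion.* With probability at least $1-\delta$, the returned policy satisfies $$\sup_{\pi\in\Pi_{\mathtt M}}\mathbb E^\pi\Big[\sum_{t=1}^hr_t(\boldsymbol x_t,\boldsymbol a_t)\Big]\le\mathbb E^{\hat\pi}\Big[\sum_{t=1}^hr_t(\boldsymbol x_t,\boldsymbol a_t)\Big]+cH\sqrt{\frac{B^2A}{\alpha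 n}\Big(\max_{t\in[h]}\ln\mathcal N_{\mathcal G_t}(1/n)+\ln\frac n\delta\Big)}+2\varepsilon h\,d^{3/2}\sum_{t=1}^hB_t,$$ where $\mathcal N_{\mathcal G}(\eta)$ is the smallest number of functions $g_1,\dots,g_N$ such that every $g\in\mathcal G$ has $\|g-g_i\|_\infty\le\eta$ for some $i$ (if some $\mathcal N_{\mathcal G_t}(1/n)$ is infinite the bound is void). -/

import Mathlib

open MeasureTheory ProbabilityTheory

noncomputable section

namespace LowRank

/-- A layered low-rank MDP with horizon `H`, feature dimension `d` and action space `A`. Layers are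
numbered `0, …, H - 1`, and the state space is the disjoint union of the types `X 0, …, X (H - 1)`
(nothing is required of `X t` for `t ≥ H`). `ν t` is the restriction of the base measure to layer
`t`, and `y ↦ ⟪μ (t + 1) y, φ t x a⟫` is the density of the transition law from `(x, a)`. -/
structure MDP (X : ℕ → Type*) [∀ t, MeasurableSpace (X t)] (A : Type*) [MeasurableSpace A]
    (d H : ℕ) where
  ρ : Measure (X 0)
  T : ∀ t, Kernel (X t × A) (X (t + 1))
  ν : ∀ t, Measure (X t)
  φ : ∀ t, X t → A → EuclideanSpace ℝ (Fin d)
  μ : ∀ t, X t → EuclideanSpace ℝ (Fin d)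
  prob_ρ : IsProbabilityMeasure ρ
  markov_T : ∀ t, t + 1 < H → IsMarkovKernel (T t)
  sigmaFinite_ν : ∀ t, t < H → SigmaFinite (ν t)
  measurable_φ : ∀ t, t < H → Measurable (fun p : X t × A => φ t p.1 p.2)
  measurable_μ : ∀ t, t < H → Measurable (μ t)
  density_nonneg : ∀ t, t + 1 < H → ∀ x a y, 0 ≤ inner ℝ (μ (t + 1) y) (φ t x a)
  T_eq : ∀ t, t + 1 < H → ∀ x a,
    T t (x, a) = (ν (t + 1)).withDensity fun y => ENNReal.ofReal (inner ℝ (μ (t + 1) y) (φ t x a))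
  norm_φ_le : ∀ t, t < H → ∀ x a, ‖φ t x a‖ ≤ 1
  integrable_μ : ∀ t, t < H → Integrable (μ t) (ν t)
  norm_μ_le : ∀ t, t < H → ∀ g : X t → ℝ, Measurable g → (∀ x, g x ∈ Set.Icc (0 : ℝ) 1) →
    ‖∫ x, g x • μ t x ∂(ν t)‖ ≤ √(d : ℝ)

/-- A randomized Markov policy: a law on actions for every state. -/
structure Policy (X : ℕ → Type*) [∀ t, MeasurableSpace (X t)] (A : Type*) [MeasurableSpace A] where
  ker : ∀ t, Kernel (X t) A
  markov : ∀ t, IsMarkovKernel (ker t)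

/-- A probability distribution over Markov policies: an index `θ` is drawn from `law` and the policy
`x ↦ ker t (θ, x)` is played. -/
structure PolicyDist (X : ℕ → Type*) [∀ t, MeasurableSpace (X t)] (A : Type*)
    [MeasurableSpace A] where
  Θ : Type*
  mΘ : MeasurableSpace Θ
  law : Measure Θ
  prob : IsProbabilityMeasure law
  ker : ∀ t, Kernel (Θ × X t) A
  markov : ∀ t, IsMarkovKernel (ker t)

variable {X : ℕ → Type*} [∀ t, MeasurableSpace (X t)] {A : Type*} [MeasurableSpace A] {d H : ℕ}

instance (P : PolicyDist X A) : MeasurableSpace P.Θ := P.mΘ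

/-- The policy with index `θ`. -/
def PolicyDist.policy (P : PolicyDist X A) (θ : P.Θ) : Policy X A where
  ker t := (P.ker t).comap (fun x => (θ, x)) measurable_prodMk_left
  markov t := by
    have := P.markov t
    infer_instance

/-- The policy that draws actions uniformly at random. -/
def unifPolicy (X : ℕ → Type*) [∀ t, MeasurableSpace (X t)] (A : Type*) [MeasurableSpace A]
    [Fintype A] [Nonempty A] : Policy X A where
  ker _ := Kernel.const _ (PMF.uniformOfFintype A).toMeasure
  markov _ := inferInstance

/-- The deterministic policy that plays `act t x` in state `x` of layer `t`. -/
def detPolicy (act : ∀ t, X t → A) (hact : ∀ t, Measurable (act t)) : Policy X A where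
  ker t := Kernel.deterministic (act t) (hact t)
  markov _ := inferInstance

/-- `π ∘_t π'`: play `π` in the layers before `t` and `π'` from layer `t` on. -/
def Policy.splice (π : Policy X A) (t : ℕ) (π' : Policy X A) : Policy X A where
  ker ℓ := if ℓ < t then π.ker ℓ else π'.ker ℓ
  markov ℓ := by
    have := π.markov ℓ
    have := π'.markov ℓ
    split_ifs <;> infer_instance

namespace MDP

/-- The law of the state `x_t` under the policy `π`. -/
def stateLaw (M : MDP X A d H) (π : Policy X A) : (t : ℕ) → Measure (X t)
  | 0 => M.ρ
  | t + 1 => (stateLaw M π t).bind fun x => (π.ker t x).bind fun a => M.T t (x, a)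

/-- The law of `r_t(x_t, a_t) + ⋯ + r_{t+k}(x_{t+k}, a_{t+k})` when the episode is started in layer
`t` with `x_t = x` and `a_t = a` and later actions are drawn from `π`. -/
def returnLaw (M : MDP X A d H) (π : Policy X A) (r : ∀ t, X t → A → ℝ) :
    ℕ → (t : ℕ) → X t → A → Measure ℝ
  | 0, t, x, a => Measure.dirac (r t x a)
  | k + 1, t, x, a =>
    ((M.T t (x, a)).bind fun y => (π.ker (t + 1) y).bind fun b =>
      returnLaw M π r k (t + 1) y b).map fun R => r t x a + R

/-- The law of `(x_t, a_t, ∑_{t ≤ ℓ < h} r_ℓ(x_ℓ, a_ℓ))` under the policy `π`, for `t < h`. -/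
def obsLaw (M : MDP X A d H) (π : Policy X A) (r : ∀ t, X t → A → ℝ) (h t : ℕ) :
    Measure (X t × A × ℝ) :=
  (M.stateLaw π t).bind fun x => (π.ker t x).bind fun a =>
    (M.returnLaw π r (h - 1 - t) t x a).map fun R => (x, a, R)

/-- The expected total reward of `π` over the first `h` layers, for `1 ≤ h`. -/
def value (M : MDP X A d H) (π : Policy X A) (r : ∀ t, X t → A → ℝ) (h : ℕ) : ℝ :=
  ∫ z, z.2.2 ∂(M.obsLaw π r h 0)

/-- The Q-function of `π` in layer `t < h`: the conditional expectation of
`∑_{t ≤ ℓ < h} r_ℓ(x_ℓ, a_ℓ)` given `x_t = x` and `a_t = a`. -/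
def Q (M : MDP X A d H) (π : Policy X A) (r : ∀ t, X t → A → ℝ) (h t : ℕ) (x : X t) (a : A) : ℝ :=
  ∫ R, R ∂(M.returnLaw π r (h - 1 - t) t x a)

/-- The occupancy density `d^π`, that is, the density of `M.stateLaw π t` with respect to `M.ν t`.
After the first layer the low-rank structure singles out the version
`x ↦ 𝔼^π[⟪μ_{t+1}(x), φ_t(x_t, a_t)⟫]`, which is defined in every point; see
`MDP.stateLaw_succ_eq_withDensity`. -/
def occ (M : MDP X A d H) (π : Policy X A) : (t : ℕ) → X t → ℝ
  | 0, x => (M.ρ.rnDeriv (M.ν 0) x).toReal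
  | t + 1, x => ∫ y, ∫ a, inner ℝ (M.μ (t + 1) x) (M.φ t y a) ∂(π.ker t y) ∂(M.stateLaw π t)

theorem stateLaw_succ (M : MDP X A d H) (π : Policy X A) (t : ℕ) (ht : t + 1 < H)
    [IsProbabilityMeasure (M.stateLaw π t)] :
    M.stateLaw π (t + 1) = ((M.stateLaw π t) ⊗ₘ (π.ker t)).bind (M.T t) := by
  have := M.markov_T t ht
  have := π.markov t
  have hm : Measurable fun x : X t => (π.ker t x).bind fun a => M.T t (x, a) := by
    refine Measure.measurable_of_measurable_coe _ fun s hs => ?_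
    have h1 : ∀ x : X t, ((π.ker t x).bind fun a => M.T t (x, a)) s
        = ∫⁻ a, M.T t (x, a) s ∂(π.ker t x) := fun x =>
      Measure.bind_apply hs ((M.T t).measurable.comp measurable_prodMk_left).aemeasurable
    simp_rw [h1]
    exact ((M.T t).measurable_coe hs).lintegral_kernel_prod_right'
  ext s hs
  rw [stateLaw, Measure.bind_apply hs hm.aemeasurable,
    Measure.bind_apply hs (M.T t).measurable.aemeasurable,
    Measure.lintegral_compProd ((M.T t).measurable_coe hs)]
  refine lintegral_congr fun x => ?_
  exact Measure.bind_apply hs ((M.T t).measurable.comp measurable_prodMk_left).aemeasurable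

theorem isProbabilityMeasure_stateLaw (M : MDP X A d H) (π : Policy X A) (t : ℕ) (ht : t < H) :
    IsProbabilityMeasure (M.stateLaw π t) := by
  induction t with
  | zero => exact M.prob_ρ
  | succ t ih =>
    have := ih (by omega)
    have := M.markov_T t ht
    have := π.markov t
    rw [M.stateLaw_succ π t ht]
    infer_instance

/-- The law of `x_{t+1}` has density `M.occ π (t + 1)` with respect to the base measure. -/
theorem stateLaw_succ_eq_withDensity (M : MDP X A d H) (π : Policy X A) (t : ℕ) (ht : t + 1 < H) :
    M.stateLaw π (t + 1) =
      (M.ν (t + 1)).withDensity fun x => ENNReal.ofReal (M.occ π (t + 1) x) := by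
  have := M.isProbabilityMeasure_stateLaw π t (by omega)
  have := M.markov_T t ht
  have := π.markov t
  have := M.sigmaFinite_ν (t + 1) ht
  have hφ := M.measurable_φ t (by omega)
  have hμ := M.measurable_μ (t + 1) ht
  have hf : Measurable fun q : (X t × A) × X (t + 1) =>
      inner ℝ (M.μ (t + 1) q.2) (M.φ t q.1.1 q.1.2) :=
    (hμ.comp measurable_snd).inner (hφ.comp measurable_fst)
  rw [M.stateLaw_succ π t ht]
  ext s hs
  rw [Measure.bind_apply hs (M.T t).measurable.aemeasurable, withDensity_apply _ hs]
  have h1 : ∀ p : X t × A, M.T t p s = ∫⁻ y in s,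
      ENNReal.ofReal (inner ℝ (M.μ (t + 1) y) (M.φ t p.1 p.2)) ∂(M.ν (t + 1)) := fun p => by
    rw [← withDensity_apply _ hs, ← M.T_eq t ht p.1 p.2]
  simp_rw [h1]
  rw [lintegral_lintegral_swap hf.ennreal_ofReal.aemeasurable]
  refine lintegral_congr fun y => ?_
  have hi : Integrable (fun p : X t × A => inner ℝ (M.μ (t + 1) y) (M.φ t p.1 p.2))
      ((M.stateLaw π t) ⊗ₘ (π.ker t)) := by
    refine Integrable.of_bound (hf.comp measurable_prodMk_right).aestronglyMeasurable
      ‖M.μ (t + 1) y‖ (ae_of_all _ fun p => ?_)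
    refine (norm_inner_le_norm _ _).trans ?_
    exact mul_le_of_le_one_right (norm_nonneg _) (M.norm_φ_le t (by omega) p.1 p.2)
  rw [occ, ← Measure.integral_compProd hi, ofReal_integral_eq_lintegral_ofReal hi]
  exact ae_of_all _ fun p => M.density_nonneg t ht p.1 p.2 y

/-- `P` is an `(α, ε)`-randomized policy cover for layer `t`. -/
def IsPolicyCover (M : MDP X A d H) (P : PolicyDist X A) (α ε : ℝ) (t : ℕ) : Prop :=
  ∀ x : X t, ε * ‖M.μ t x‖ ≤ (⨆ π : Policy X A, M.occ π t x) →
    α * (⨆ π : Policy X A, M.occ π t x) ≤ ∫ θ, M.occ (P.policy θ) t x ∂P.law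

/-- The function classes `G 0, …, G (h - 1)` realize the rewards. -/
def Realizes (M : MDP X A d H) (G : ∀ t, Set (X t → A → ℝ)) (r : ∀ t, X t → A → ℝ) (h : ℕ) :
    Prop :=
  ∀ t, t < h → ∀ π : Policy X A, M.Q π r h t ∈ G t

/-- The law of one sample of PSDP in layer `t`: draw `π ∼ P`, play `π` before layer `t`, a uniform
action in layer `t` and `π'` afterwards, and record `(x_t, a_t, ∑_{t ≤ ℓ < h} r_ℓ(x_ℓ, a_ℓ))`. -/
def sampleLaw [Fintype A] [Nonempty A] (M : MDP X A d H) (P : PolicyDist X A) (π' : Policy X A)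
    (r : ∀ t, X t → A → ℝ) (h t : ℕ) : Measure (X t × A × ℝ) :=
  P.law.bind fun θ =>
    M.obsLaw (((P.policy θ).splice t (unifPolicy X A)).splice (t + 1) π') r h t

end MDP

/-- The covering number of a class `G` of functions in `ℓ_∞`-distance at scale `ε`; it is `⊤` if
there is no finite cover. -/
def coveringNumber {S A : Type*} (G : Set (S → A → ℝ)) (ε : ℝ) : ℕ∞ :=
  ⨅ (N : ℕ) (_ : ∃ c : Fin N → S → A → ℝ, ∀ g ∈ G, ∃ i, ∀ x a, |g x a - c i x a| ≤ ε), (N : ℕ∞)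

/-- An execution of `PSDP(h, r, G, P, n)` on a probability space `(Ω, Pr)`. The layers are processed
in the order `t = h - 1, …, 0`; `hist t` is the information available once layer `t` has been
processed (it contains the data sets and the choices made among minimizers and maximizers in the
layers `t, …, h - 1`). -/
structure PSDPRun [Fintype A] [Nonempty A] (M : MDP X A d H) (h : ℕ) (r : ∀ t, X t → A → ℝ)
    (G : ∀ t, Set (X t → A → ℝ)) (P : ℕ → PolicyDist X A) (n : ℕ)
    {Ω : Type*} [mΩ : MeasurableSpace Ω] (Pr : Measure Ω) where
  hist : ℕ → MeasurableSpace Ω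
  hist_le : ∀ t, hist t ≤ mΩ
  hist_succ_le : ∀ t, hist (t + 1) ≤ hist t
  /-- the data set of layer `t` -/
  data : ∀ t : Fin h, Ω → Fin n → X t × A × ℝ
  /-- the regression function of layer `t` -/
  ghat : ∀ t : Fin h, Ω → X t → A → ℝ
  /-- the action of the learned policy in the states of layer `t` -/
  act : ∀ t, Ω → X t → A
  measurable_data : ∀ t : Fin h, Measurable[hist t] (data t)
  measurable_act : ∀ t ω, Measurable (act t ω)
  measurable_act_uncurry : ∀ t,
    @Measurable (Ω × X t) A ((hist t).prod inferInstance) _ fun p => act t p.1 p.2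
  /-- Given the past, the data set of layer `t` consists of `n` independent samples. -/
  data_law : ∀ t : Fin h, ∀ E, MeasurableSet[hist ((t : ℕ) + 1)] E → ∀ S, MeasurableSet S →
    Pr (E ∩ data t ⁻¹' S) = ∫⁻ ω in E, Measure.pi (fun _ : Fin n =>
      M.sampleLaw (P t) (detPolicy (fun ℓ => act ℓ ω) (fun ℓ => measurable_act ℓ ω)) r h t) S ∂Pr
  ghat_mem : ∀ (t : Fin h) ω, ghat t ω ∈ G t
  ghat_le : ∀ t : Fin h, ∀ ω, ∀ g ∈ G t,
    ∑ i, (ghat t ω (data t ω i).1 (data t ω i).2.1 - (data t ω i).2.2) ^ 2 ≤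
      ∑ i, (g (data t ω i).1 (data t ω i).2.1 - (data t ω i).2.2) ^ 2
  ghat_act : ∀ t : Fin h, ∀ ω x a, ghat t ω x a ≤ ghat t ω x (act t ω x)

/-- The policy returned by the run (its values in the layers `t ≥ h` are irrelevant). -/
def PSDPRun.output [Fintype A] [Nonempty A] {M : MDP X A d H} {h : ℕ} {r : ∀ t, X t → A → ℝ}
    {G : ∀ t, Set (X t → A → ℝ)} {P : ℕ → PolicyDist X A} {n : ℕ}
    {Ω : Type*} [MeasurableSpace Ω] {Pr : Measure Ω} (run : PSDPRun M h r G P n Pr) (ω : Ω) :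
    Policy X A :=
  detPolicy (fun t => run.act t ω) (fun t => run.measurable_act t ω)

end LowRank

end

/-! The regret is split by the performance difference lemma: `value π - value σ`, with `σ` the
output, is the sum over layers of the mean advantage of `π` over `σ`, measured by `Q^σ` at states
drawn from `π`. In each layer, states are split into an exceptional set `C`, where the policy cover
gives nothing, and its complement, where the law under `π` is at most `α⁻¹` times the sampling law.

Off `C`, greediness bounds the advantage by twice the largest error `|ĝ - Q^σ|` over actions.
Cauchy–Schwarz, the change of measure and the uniform exploration action turn this into `√(4 α⁻¹ A
e)`, with `e` the mean squared regression error. Realizability for every policy puts the random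
target `Q^σ` in the class. Conditionally on the later layers the data are i.i.d. with regression
function `Q^σ`, and the variance of the excess squared loss is at most a multiple of its mean. A
Bernstein bound over a finite net, whose points do not depend on the past, therefore gives the fast
rate `e ≲ B² (ln N + ln (n/δ)) / n`.

On `C` the advantage is at most `2 ∑ Bd`, and the density of `π` is at most `ε ‖μ‖`, so `C` has
probability at most `ε ∫_C ‖μ‖`. Summing coordinates of the signed field `μ` gives `∫ ‖μ‖ ≤ 2
d^(3/2)`, which is too large by a factor 2 for the stated constant. The improvement
(`setIntegral_norm_le_of_density`, `le_of_variation_bound`) averages `∫_C |⟨μ, g⟩|` over a Gaussian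
`g`. For fixed `g` this is `⟨g, V - V'⟩` for two partial integrals of `μ` of norm at most `√d`; as
`μ` has total mass one against a feature vector of norm at most one, `V + V'` is long and the
parallelogram law shortens `V - V'`. The result is `h/(h-1) · d^(3/2)`, and the factor `h/(h-1)`
costs nothing because the first layer has no exceptional set.

Two regimes are trivial: if `n ≤ H²` the statistical term exceeds `2B`, and if `ε h d^(3/2) > 1` the
cover term exceeds `2 ∑ Bd`. Outside them `h ≤ n`, so failure probability `δ/n` per layer suffices
for the union bound. -/

namespace LowRank

/-! ### Measures depending measurably on a parameter, and conditional laws -/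

section Measurability

variable {Θ Y Z : Type*} [MeasurableSpace Θ] [MeasurableSpace Y] [MeasurableSpace Z]

/-- A measure-valued `bind` depends measurably on a parameter. -/
theorem measurable_bind_param {μ : Θ → Measure Y} (hμ : Measurable μ)
    [∀ θ, IsProbabilityMeasure (μ θ)] {f : Θ → Y → Measure Z}
    (hf : Measurable fun p : Θ × Y => f p.1 p.2) :
    Measurable fun θ => (μ θ).bind (f θ) := by
  let κ : Kernel Θ Y := ⟨μ, hμ⟩
  have : IsMarkovKernel κ := ⟨fun θ => inferInstanceAs (IsProbabilityMeasure (μ θ))⟩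
  refine Measure.measurable_of_measurable_coe _ fun s hs => ?_
  have h1 : ∀ θ, ((μ θ).bind (f θ)) s = ∫⁻ y, f θ y s ∂(κ θ) := fun θ =>
    Measure.bind_apply hs (hf.comp measurable_prodMk_left).aemeasurable
  simp_rw [h1]
  exact ((Measure.measurable_coe hs).comp hf).lintegral_kernel_prod_right'

/-- A push-forward measure depends measurably on a parameter. -/
theorem measurable_map_param {μ : Θ → Measure Y} (hμ : Measurable μ)
    [∀ θ, IsProbabilityMeasure (μ θ)] {f : Θ → Y → Z}
    (hf : Measurable fun p : Θ × Y => f p.1 p.2) :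
    Measurable fun θ => (μ θ).map (f θ) := by
  have h1 : ∀ θ, (μ θ).map (f θ) = (μ θ).bind fun y => Measure.dirac (f θ y) := fun θ =>
    (Measure.bind_dirac_eq_map _ (hf.comp measurable_prodMk_left)).symm
  simp_rw [h1]
  exact measurable_bind_param hμ (Measure.measurable_dirac.comp hf)

/-- A finite power of a probability measure depends measurably on a parameter. -/
theorem measurable_pi_param {n : ℕ} {μ : Θ → Measure Y} (hμ : Measurable μ)
    [∀ θ, IsProbabilityMeasure (μ θ)] :
    Measurable fun θ => Measure.pi fun _ : Fin n => μ θ := by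
  refine Measurable.measure_of_isPiSystem_of_isProbabilityMeasure generateFrom_pi.symm
    isPiSystem_pi ?_
  rintro _ ⟨s, hs, rfl⟩
  simp only [Measure.pi_pi]
  refine Finset.measurable_prod _ fun i _ => ?_
  exact (Measure.measurable_coe (hs i (Set.mem_univ i))).comp hμ

/-- If `κ` is the conditional law of `f` given the map `p`, an event with conditional probability
at most `η` has probability at most `η`. -/
theorem measure_preimage_le_of_conditional_law {Ω : Type*} [MeasurableSpace Ω] {Pr : Measure Ω}
    [IsProbabilityMeasure Pr] {p : Ω → Θ} (hp : Measurable p) {f : Ω → Y} (hf : Measurable f)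
    {κ : Θ → Measure Y} (hκ : Measurable κ) [∀ θ, IsProbabilityMeasure (κ θ)]
    (hlaw : ∀ E, MeasurableSet E → ∀ S, MeasurableSet S →
      Pr (p ⁻¹' E ∩ f ⁻¹' S) = ∫⁻ ω in p ⁻¹' E, κ (p ω) S ∂Pr)
    {U : Set (Θ × Y)} (hU : MeasurableSet U) {η : ENNReal}
    (hη : ∀ θ, κ θ (Prod.mk θ ⁻¹' U) ≤ η) : Pr {ω | (p ω, f ω) ∈ U} ≤ η := by
  let K : Kernel Θ Y := ⟨κ, hκ⟩
  have : IsMarkovKernel K := ⟨fun θ => inferInstanceAs (IsProbabilityMeasure (κ θ))⟩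
  have : IsProbabilityMeasure (Pr.map p) := Measure.isProbabilityMeasure_map hp.aemeasurable
  have hpf : Measurable fun ω => (p ω, f ω) := hp.prodMk hf
  have : IsProbabilityMeasure (Pr.map fun ω => (p ω, f ω)) :=
    Measure.isProbabilityMeasure_map hpf.aemeasurable
  -- Rectangles determine a finite measure on a product, so `hlaw` identifies the joint law; the
  -- bound `η` then holds section by section.
  have key : Pr.map (fun ω => (p ω, f ω)) = (Pr.map p) ⊗ₘ K := by
    refine Measure.ext_prod fun {s t} hs ht => ?_
    rw [Measure.map_apply hpf (hs.prod ht), Measure.compProd_apply_prod hs ht,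
      setLIntegral_map hs (K.measurable_coe ht) hp]
    exact hlaw s hs t ht
  calc Pr {ω | (p ω, f ω) ∈ U} = Pr.map (fun ω => (p ω, f ω)) U := (Measure.map_apply hpf hU).symm
    _ = ∫⁻ θ, K θ (Prod.mk θ ⁻¹' U) ∂(Pr.map p) := by rw [key, Measure.compProd_apply hU]
    _ ≤ ∫⁻ _, η ∂(Pr.map p) := lintegral_mono fun θ => hη θ
    _ = η := by simp

end Measurability

/-! ### Exponential moments and concentration -/

section Concentration

theorem exp_le_one_add_add_sq {x : ℝ} (hx : |x| ≤ 1) : Real.exp x ≤ 1 + x + x ^ 2 := by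
  have := Real.abs_exp_sub_one_sub_id_le hx
  have := (abs_le.1 this).2
  linarith

theorem integrable_of_abs_le {Z : Type*} [MeasurableSpace Z] {ν : Measure Z} [IsFiniteMeasure ν]
    {f : Z → ℝ} (hf : Measurable f) {C : ℝ} (hC : ∀ᵐ z ∂ν, |f z| ≤ C) : Integrable f ν :=
  Integrable.of_bound hf.aestronglyMeasurable C (by simpa using hC)

/-- A one-sided Bernstein bound for variables whose variance is controlled by their mean. -/
theorem pi_deviation_le {Z : Type*} [MeasurableSpace Z] {ν : Measure Z} [IsProbabilityMeasure ν]
    {D : Z → ℝ} (hD : Measurable D) {lam V e : ℝ} (hlam : 0 < lam)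
    (hb : ∀ᵐ z ∂ν, |lam * D z| ≤ 1) (he : ∫ z, D z ∂ν = e)
    (hV : ∫ z, D z ^ 2 ∂ν ≤ V * e) (hlV : lam * V ≤ 1 / 2) (he0 : 0 ≤ e) (n : ℕ) (L : ℝ) :
    Measure.pi (fun _ : Fin n => ν) {z | L ≤ ∑ k, -(lam * D (z k)) + n * (lam * e / 2)}
      ≤ ENNReal.ofReal (Real.exp (-L)) := by
  have hDb : ∀ᵐ z ∂ν, |D z| ≤ 1 / lam := by
    filter_upwards [hb] with z hz
    rw [abs_mul, abs_of_pos hlam] at hz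
    rw [le_div_iff₀ hlam]; linarith
  have hDi : Integrable D ν := integrable_of_abs_le hD hDb
  have hD2 : Integrable (fun z => D z ^ 2) ν := by
    refine integrable_of_abs_le (hD.pow_const 2) (C := (1 / lam) ^ 2) ?_
    filter_upwards [hDb] with z hz
    rw [abs_pow]
    exact pow_le_pow_left₀ (abs_nonneg _) hz 2
  have hEi : Integrable (fun z => Real.exp (-(lam * D z))) ν := by
    refine integrable_of_abs_le (by fun_prop) (C := Real.exp 1) ?_
    filter_upwards [hb] with z hz
    rw [Real.abs_exp, Real.exp_le_exp]
    have := (abs_le.1 hz).1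
    linarith
  have h1 : ∫ z, Real.exp (-(lam * D z)) ∂ν ≤ Real.exp (-(lam * e / 2)) := by
    calc ∫ z, Real.exp (-(lam * D z)) ∂ν
        ≤ ∫ z, (1 + -(lam * D z) + lam ^ 2 * D z ^ 2) ∂ν := by
          refine integral_mono_ae hEi (by fun_prop) ?_
          filter_upwards [hb] with z hz
          have := exp_le_one_add_add_sq (x := -(lam * D z)) (by rwa [abs_neg])
          calc _ ≤ _ := this
            _ = _ := by ring
      _ = 1 + -(lam * e) + lam ^ 2 * ∫ z, D z ^ 2 ∂ν := by
          rw [integral_add (by fun_prop) (by fun_prop), integral_add (by fun_prop) (by fun_prop),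
            integral_neg, integral_const_mul, integral_const_mul, he]
          simp
      _ ≤ 1 + -(lam * e) + lam ^ 2 * (V * e) := by gcongr
      -- Since `lam * V ≤ 1/2`, the quadratic term absorbs only half of the linear drift.
      _ ≤ 1 + -(lam * e / 2) := by nlinarith [mul_nonneg hlam.le he0]
      _ ≤ Real.exp (-(lam * e / 2)) := by
          have := Real.add_one_le_exp (-(lam * e / 2)); linarith
  have h2 : ∫ z, ∏ k : Fin n, Real.exp (-(lam * D (z k))) ∂(Measure.pi fun _ : Fin n => ν)
      ≤ Real.exp (-(n * (lam * e / 2))) := by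
    rw [integral_fintype_prod_eq_pow (fun z => Real.exp (-(lam * D z))), Fintype.card_fin]
    calc _ ≤ Real.exp (-(lam * e / 2)) ^ n := by
          gcongr
      _ = _ := by rw [← Real.exp_nat_mul]; ring_nf
  have h3 : Integrable (fun z : Fin n → Z => ∏ k : Fin n, Real.exp (-(lam * D (z k))))
      (Measure.pi fun _ : Fin n => ν) := Integrable.fintype_prod fun _ => hEi
  -- Markov's inequality for the exponential; the threshold is the event of the statement after
  -- exponentiation.
  have h4 := mul_meas_ge_le_integral_of_nonneg
    (ae_of_all _ fun z => Finset.prod_nonneg fun k _ => (Real.exp_pos _).le) h3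
    (Real.exp (L - n * (lam * e / 2)))
  have h5 : {z : Fin n → Z | L ≤ ∑ k, -(lam * D (z k)) + n * (lam * e / 2)} =
      {z | Real.exp (L - n * (lam * e / 2)) ≤ ∏ k : Fin n, Real.exp (-(lam * D (z k)))} := by
    ext z
    simp only [Set.mem_ofPred_eq]
    rw [← Real.exp_sum, Real.exp_le_exp, sub_le_iff_le_add]
  rw [h5]
  rw [ENNReal.le_ofReal_iff_toReal_le (measure_ne_top _ _) (Real.exp_pos _).le]
  have h6 := h4.trans h2
  rw [Real.exp_neg] at h6 ⊢
  have hp0 : Real.exp (L - n * (lam * e / 2)) = Real.exp L / Real.exp (n * (lam * e / 2)) :=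
    Real.exp_sub _ _
  have hp1 := Real.exp_pos L
  have hp2 := Real.exp_pos (n * (lam * e / 2))
  set T := {z : Fin n → Z | Real.exp (L - n * (lam * e / 2)) ≤
    ∏ k : Fin n, Real.exp (-(lam * D (z k)))}
  rw [hp0, div_mul_eq_mul_div, div_le_iff₀ hp2, inv_mul_cancel₀ hp2.ne'] at h6
  rw [← one_div, le_div_iff₀ hp1, mul_comm]
  exact h6

end Concentration

/-! ### Least squares with fast rates over a finite net -/

section Regression

variable {Θ W : Type*} [MeasurableSpace Θ] [MeasurableSpace W]

/-- The excess squared loss of the predictor `g` over the predictor `q` at the sample `z`. -/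
def excessLoss (g q : W → ℝ) (z : W × ℝ) : ℝ := (g z.1 - z.2) ^ 2 - (q z.1 - z.2) ^ 2

theorem measurable_excessLoss {g q : W → ℝ} (hg : Measurable g) (hq : Measurable q) :
    Measurable (excessLoss g q) := by
  unfold excessLoss; fun_prop

theorem abs_integral_le_of_ae {Z : Type*} [MeasurableSpace Z] {ν : Measure Z}
    [IsProbabilityMeasure ν] {f : Z → ℝ} {C : ℝ} (hC : ∀ᵐ z ∂ν, |f z| ≤ C) :
    |∫ z, f z ∂ν| ≤ C := by
  simpa using norm_integral_le_of_norm_le_const (μ := ν) (f := f) (C := C) (by simpa using hC)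

theorem measurable_kernel_mean (K : Kernel W ℝ) : Measurable fun w => ∫ R, R ∂(K w) :=
  (measurable_id.stronglyMeasurable.integral_kernel (κ := K)).measurable

/-- With `q` the conditional mean, the excess loss factors as `(g - q)(g + q - 2R)`. The second
factor is at most `4B`, and its conditional mean is `g - q`. Hence the second moment is controlled
by the mean, which is the input for a rate `1/n` rather than `1/√n`. -/
theorem excessLoss_moments {τ : Measure W} [IsProbabilityMeasure τ] {K : Kernel W ℝ}
    [IsMarkovKernel K] {B : ℝ} (hR : ∀ w, ∀ᵐ R ∂(K w), |R| ≤ B) {g : W → ℝ} (hg : Measurable g)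
    (hgB : ∀ w, |g w| ≤ B) :
    (∀ᵐ z ∂(τ ⊗ₘ K), |excessLoss g (fun w => ∫ R, R ∂(K w)) z| ≤ 8 * B ^ 2) ∧
    ∫ z, excessLoss g (fun w => ∫ R, R ∂(K w)) z ∂(τ ⊗ₘ K)
      = ∫ w, (g w - ∫ R, R ∂(K w)) ^ 2 ∂τ ∧
    ∫ z, excessLoss g (fun w => ∫ R, R ∂(K w)) z ^ 2 ∂(τ ⊗ₘ K)
      ≤ 16 * B ^ 2 * ∫ w, (g w - ∫ R, R ∂(K w)) ^ 2 ∂τ := by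
  set q : W → ℝ := fun w => ∫ R, R ∂(K w) with hqdef
  have hq : Measurable q := measurable_kernel_mean K
  have hqB : ∀ w, |q w| ≤ B := fun w => abs_integral_le_of_ae (hR w)
  have hm := measurable_excessLoss hg hq
  have hRae : ∀ᵐ z ∂(τ ⊗ₘ K), |z.2| ≤ B := by
    rw [Measure.ae_compProd_iff (p := fun z : W × ℝ => |z.2| ≤ B)
      (measurableSet_le (by fun_prop) (by fun_prop))]
    exact ae_of_all _ hR
  have h1 : ∀ᵐ z ∂(τ ⊗ₘ K), |excessLoss g q z| ≤ 8 * B ^ 2 := by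
    filter_upwards [hRae] with z hz
    have e : excessLoss g q z = (g z.1 - q z.1) * (g z.1 + q z.1 - 2 * z.2) := by
      unfold excessLoss; ring
    have a1 : |g z.1 - q z.1| ≤ 2 * B := by
      have := abs_sub (g z.1) (q z.1); linarith [hgB z.1, hqB z.1]
    have a2 : |g z.1 + q z.1 - 2 * z.2| ≤ 4 * B := by
      have b1 := abs_le.1 (hgB z.1)
      have b2 := abs_le.1 (hqB z.1)
      have b3 := abs_le.1 hz
      rw [abs_le]; constructor <;> linarith
    rw [e, abs_mul]
    calc _ ≤ (2 * B) * (4 * B) :=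
          mul_le_mul a1 a2 (abs_nonneg _) (by have := abs_nonneg (g z.1 - q z.1); linarith)
      _ = _ := by ring
  have hsq : Measurable fun w => (g w - q w) ^ 2 := by fun_prop
  have hi : Integrable (excessLoss g q) (τ ⊗ₘ K) := integrable_of_abs_le hm h1
  have hi2 : Integrable (fun z => excessLoss g q z ^ 2) (τ ⊗ₘ K) := by
    refine integrable_of_abs_le (hm.pow_const 2) (C := (8 * B ^ 2) ^ 2) ?_
    filter_upwards [h1] with z hz
    rw [abs_pow]
    exact pow_le_pow_left₀ (abs_nonneg _) hz 2
  have hisq : Integrable (fun w => (g w - q w) ^ 2) τ := by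
    refine integrable_of_abs_le hsq (C := (2 * B) ^ 2) (ae_of_all _ fun w => ?_)
    rw [abs_pow]
    refine pow_le_pow_left₀ (abs_nonneg _) ?_ 2
    have := abs_sub (g w) (q w); linarith [hgB w, hqB w]
  refine ⟨h1, ?_, ?_⟩
  · rw [Measure.integral_compProd hi]
    refine integral_congr_ae (ae_of_all _ fun w => ?_)
    have hRi : Integrable (fun R : ℝ => R) (K w) := integrable_of_abs_le measurable_id (hR w)
    have e : ∀ R : ℝ, excessLoss g q (w, R) = (g w ^ 2 - q w ^ 2) - 2 * (g w - q w) * R := by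
      intro R; unfold excessLoss; ring
    simp_rw [e]
    rw [integral_sub (integrable_const _) (hRi.const_mul _), integral_const_mul]
    simp only [integral_const, probReal_univ, one_smul]
    change g w ^ 2 - q w ^ 2 - 2 * (g w - q w) * q w = (g w - q w) ^ 2
    ring
  · have h3 : ∫ z, (g z.1 - q z.1) ^ 2 ∂(τ ⊗ₘ K) = ∫ w, (g w - q w) ^ 2 ∂τ := by
      have := integral_map (μ := τ ⊗ₘ K) (φ := Prod.fst) measurable_fst.aemeasurable
        (f := fun w => (g w - q w) ^ 2) hsq.aestronglyMeasurable
      refine this.symm.trans ?_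
      change ∫ w, (g w - q w) ^ 2 ∂(τ ⊗ₘ K).fst = _
      rw [Measure.fst_compProd]
    have hisq' : Integrable (fun z : W × ℝ => (g z.1 - q z.1) ^ 2) (τ ⊗ₘ K) := by
      refine integrable_of_abs_le (by fun_prop) (C := (2 * B) ^ 2) (ae_of_all _ fun z => ?_)
      rw [abs_pow]
      refine pow_le_pow_left₀ (abs_nonneg _) ?_ 2
      have := abs_sub (g z.1) (q z.1); linarith [hgB z.1, hqB z.1]
    rw [← h3, ← integral_const_mul]
    refine integral_mono_ae hi2 (hisq'.const_mul _) ?_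
    filter_upwards [hRae] with z hz
    have e : excessLoss g q z ^ 2 = (g z.1 + q z.1 - 2 * z.2) ^ 2 * (g z.1 - q z.1) ^ 2 := by
      unfold excessLoss; ring
    rw [e]
    have a2 : (g z.1 + q z.1 - 2 * z.2) ^ 2 ≤ 16 * B ^ 2 := by
      have b1 := abs_le.1 (hgB z.1)
      have b2 := abs_le.1 (hqB z.1)
      have b3 := abs_le.1 hz
      nlinarith
    exact mul_le_mul_of_nonneg_right a2 (sq_nonneg _)

/-- Uniform control of the squared error over a finite class, when the data are independent samples
given a parameter: the law of a sample is `τ ⊗ₘ K.sectR θ`. -/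
theorem measure_regression_failure_le {Ω : Type*} [MeasurableSpace Ω] {Pr : Measure Ω}
    [IsProbabilityMeasure Pr] {n N : ℕ} {p : Ω → Θ} (hp : Measurable p)
    {data : Ω → Fin n → W × ℝ} (hdata : Measurable data)
    {τ : Measure W} [IsProbabilityMeasure τ] {K : Kernel (Θ × W) ℝ} [IsMarkovKernel K]
    (hlaw : ∀ E, MeasurableSet E → ∀ S, MeasurableSet S →
      Pr (p ⁻¹' E ∩ data ⁻¹' S) =
        ∫⁻ ω in p ⁻¹' E, Measure.pi (fun _ : Fin n => τ ⊗ₘ K.sectR (p ω)) S ∂Pr)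
    {B : ℝ} (hB : 1 ≤ B) (hR : ∀ v, ∀ᵐ R ∂(K v), |R| ≤ B) {g : Fin N → W → ℝ}
    (hg : ∀ i, Measurable (g i)) (hgB : ∀ i w, |g i w| ≤ B) (L : ℝ) :
    Pr {ω | ¬ ((∀ k, |(data ω k).2| ≤ B) ∧
        ∀ i, n * ∫ w, (g i w - ∫ R, R ∂(K (p ω, w))) ^ 2 ∂τ ≤
          2 * ∑ k, excessLoss (g i) (fun w => ∫ R, R ∂(K (p ω, w))) (data ω k) + 64 * B ^ 2 * L)}
      ≤ N * ENNReal.ofReal (Real.exp (-L)) := by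
  have hB2 : 0 < B ^ 2 := by positivity
  set q : Θ → W → ℝ := fun θ w => ∫ R, R ∂(K (θ, w)) with hqdef
  have hq : Measurable fun v : Θ × W => q v.1 v.2 := measurable_kernel_mean K
  set e : Fin N → Θ → ℝ := fun i θ => ∫ w, (g i w - q θ w) ^ 2 ∂τ with hedef
  have he : ∀ i, Measurable (e i) := fun i => by
    have : Measurable fun v : Θ × W => (g i v.2 - q v.1 v.2) ^ 2 :=
      (((hg i).comp measurable_snd).sub hq).pow_const 2
    exact (this.stronglyMeasurable.integral_prod_right' (ν := τ)).measurable
  let D : Fin N → Θ → W × ℝ → ℝ := fun i θ => excessLoss (g i) (q θ)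
  have hD : ∀ i (k : Fin n), Measurable fun v : Θ × (Fin n → W × ℝ) => D i v.1 (v.2 k) := by
    intro i k
    have h1 : Measurable fun v : Θ × (Fin n → W × ℝ) => q v.1 (v.2 k).1 :=
      hq.comp (measurable_fst.prodMk (by fun_prop))
    have h2 : Measurable fun v : Θ × (Fin n → W × ℝ) => g i (v.2 k).1 := (hg i).comp (by fun_prop)
    have h3 : Measurable fun v : Θ × (Fin n → W × ℝ) => (v.2 k).2 := by fun_prop
    exact ((h2.sub h3).pow_const 2).sub ((h1.sub h3).pow_const 2)
  -- This makes `lam * V = 1/2` for the variance factor `V = 16 B²`, and `lam * 8 B² = 1/4 ≤ 1`.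
  set lam : ℝ := 1 / (32 * B ^ 2) with hlamdef
  have hlam : 0 < lam := by positivity
  let U0 : Set (Θ × (Fin n → W × ℝ)) := ⋃ k, {v | B < |(v.2 k).2|}
  let U1 : Fin N → Set (Θ × (Fin n → W × ℝ)) := fun i =>
    {v | L ≤ ∑ k, -(lam * D i v.1 (v.2 k)) + n * (lam * e i v.1 / 2)}
  have hU0 : MeasurableSet U0 :=
    MeasurableSet.iUnion fun k => measurableSet_lt (by fun_prop) (by fun_prop)
  have hU1 : ∀ i, MeasurableSet (U1 i) := fun i => by
    refine measurableSet_le measurable_const (Measurable.add ?_ ?_)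
    · exact Finset.measurable_sum _ fun k _ => ((hD i k).const_mul lam).neg
    · exact (((he i).comp measurable_fst).const_mul lam).div_const 2 |>.const_mul _
  have hκ : Measurable fun θ => τ ⊗ₘ K.sectR θ := by
    refine Measure.measurable_of_measurable_coe _ fun s hs => ?_
    simp_rw [Measure.compProd_apply hs]
    have h2 : Measurable fun v : Θ × W => K v (Prod.mk v.2 ⁻¹' s) := by
      have hs' : MeasurableSet {u : (Θ × W) × ℝ | (u.1.2, u.2) ∈ s} :=
        hs.preimage (by fun_prop : Measurable fun u : (Θ × W) × ℝ => (u.1.2, u.2))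
      exact Kernel.measurable_kernel_prodMk_left (κ := K) hs'
    exact h2.lintegral_prod_right' (ν := τ)
  have hpi := measurable_pi_param (n := n) hκ
  have hRθ : ∀ θ w, ∀ᵐ R ∂(K.sectR θ w), |R| ≤ B := fun θ w => by
    rw [Kernel.sectR_apply]; exact hR _
  -- The target `q` depends on the past `θ`, so the bad event is covered by a measurable set of
  -- pairs (past, data) and estimated for each fixed `θ`. There `U0` is null and each `U1 i` is a
  -- Bernstein event.
  refine le_trans (measure_mono ?_) (measure_preimage_le_of_conditional_law hp hdata hpi hlaw
    (U := U0 ∪ ⋃ i, U1 i) (hU0.union (MeasurableSet.iUnion hU1)) (η := N * ENNReal.ofReal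
      (Real.exp (-L))) fun θ => ?_)
  · intro ω hω
    by_contra hc
    refine hω ⟨fun k => ?_, fun i => ?_⟩
    · by_contra hk
      exact hc (Or.inl (Set.mem_iUnion.2 ⟨k, not_le.1 hk⟩))
    · have h1 : ¬ (L ≤ ∑ k, -(lam * D i (p ω) (data ω k)) + n * (lam * e i (p ω) / 2)) :=
        fun hi => hc (Or.inr (Set.mem_iUnion.2 ⟨i, hi⟩))
      rw [not_le, Finset.sum_neg_distrib, ← Finset.mul_sum] at h1
      change n * e i (p ω) ≤ 2 * ∑ k, D i (p ω) (data ω k) + 64 * B ^ 2 * L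
      have h2 : 64 * B ^ 2 * lam = 2 := by rw [hlamdef]; field_simp; norm_num
      have h3 := mul_lt_mul_of_pos_left h1 (by positivity : 0 < 64 * B ^ 2)
      have h4 : 64 * B ^ 2 * (-(lam * ∑ k, D i (p ω) (data ω k)) + n * (lam * e i (p ω) / 2))
          = -(64 * B ^ 2 * lam) * ∑ k, D i (p ω) (data ω k)
            + n * ((64 * B ^ 2 * lam) * e i (p ω) / 2) := by ring
      rw [h4, h2] at h3
      linarith
  · have hset : Prod.mk θ ⁻¹' (U0 ∪ ⋃ i, U1 i)
        = (Prod.mk θ ⁻¹' U0) ∪ ⋃ i, (Prod.mk θ ⁻¹' U1 i) := by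
      rw [Set.preimage_union, Set.preimage_iUnion (s := U1)]
    rw [hset]
    have hz : Measure.pi (fun _ : Fin n => τ ⊗ₘ K.sectR θ) (Prod.mk θ ⁻¹' U0) = 0 := by
      have : Prod.mk θ ⁻¹' U0 = ⋃ k : Fin n, (fun z : Fin n → W × ℝ => z k) ⁻¹' {u | B < |u.2|} := by
        rw [Set.preimage_iUnion]; rfl
      rw [this, measure_iUnion_null_iff]
      intro k
      have hms : MeasurableSet {u : W × ℝ | B < |u.2|} :=
        measurableSet_lt (by fun_prop) (by fun_prop)
      rw [(measurePreserving_eval (fun _ : Fin n => τ ⊗ₘ K.sectR θ) k).measure_preimage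
        hms.nullMeasurableSet]
      have hae : ∀ᵐ z ∂(τ ⊗ₘ K.sectR θ), |z.2| ≤ B := by
        rw [Measure.ae_compProd_iff (p := fun z : W × ℝ => |z.2| ≤ B)
          (measurableSet_le (by fun_prop) (by fun_prop))]
        exact ae_of_all _ (hRθ θ)
      simpa [ae_iff, not_le] using hae
    have hone : ∀ i, Measure.pi (fun _ : Fin n => τ ⊗ₘ K.sectR θ) (Prod.mk θ ⁻¹' U1 i)
        ≤ ENNReal.ofReal (Real.exp (-L)) := fun i => by
      obtain ⟨m1, m2, m3⟩ := excessLoss_moments (τ := τ) (hRθ θ) (hg i) (hgB i)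
      have hqθ : Measurable (q θ) := hq.comp measurable_prodMk_left
      simp only [Kernel.sectR_apply] at m1 m2 m3
      refine pi_deviation_le (D := D i θ) (lam := lam) (V := 16 * B ^ 2) (e := e i θ)
        (measurable_excessLoss (hg i) hqθ) hlam ?_ m2 m3 ?_ ?_ n L
      · filter_upwards [m1] with z hz
        rw [abs_mul, abs_of_pos hlam]
        calc lam * |D i θ z| ≤ lam * (8 * B ^ 2) := by gcongr
          _ ≤ 1 := by rw [hlamdef]; field_simp; norm_num
      · rw [hlamdef]; apply le_of_eq; field_simp; norm_num
      · exact integral_nonneg fun w => sq_nonneg _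
    calc _ ≤ Measure.pi (fun _ : Fin n => τ ⊗ₘ K.sectR θ) (Prod.mk θ ⁻¹' U0)
          + Measure.pi (fun _ : Fin n => τ ⊗ₘ K.sectR θ) (⋃ i, (Prod.mk θ ⁻¹' U1 i)) :=
          measure_union_le _ _
      _ ≤ 0 + ∑ i : Fin N, ENNReal.ofReal (Real.exp (-L)) := by
          rw [hz]
          gcongr
          refine (measure_iUnion_fintype_le _ _).trans ?_
          exact Finset.sum_le_sum fun i _ => hone i
      _ = _ := by simp

/-- The squared error of an empirical risk minimizer, given the uniform control of the squared errors
of the elements of a net. -/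
theorem integral_sq_le_of_empirical_le {n N : ℕ} (hn : 1 ≤ n) {τ : Measure W}
    [IsProbabilityMeasure τ] {B L : ℝ} (hB : 1 ≤ B) {g : Fin N → W → ℝ} {q ghat : W → ℝ}
    (hg : ∀ i, Measurable (g i)) (hq : Measurable q) (hgh : Measurable ghat)
    (hgB : ∀ i w, |g i w| ≤ B) (hqB : ∀ w, |q w| ≤ B) (hghB : ∀ w, |ghat w| ≤ B)
    {data : Fin n → W × ℝ} (hdata : ∀ k, |(data k).2| ≤ B)
    (hctl : ∀ i, n * ∫ w, (g i w - q w) ^ 2 ∂τ ≤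
      2 * ∑ k, excessLoss (g i) q (data k) + 64 * B ^ 2 * L)
    (herm : ∑ k, (ghat (data k).1 - (data k).2) ^ 2 ≤ ∑ k, (q (data k).1 - (data k).2) ^ 2)
    (hnet : ∃ i, ∀ w, |ghat w - g i w| ≤ 2 / n) :
    n * ∫ w, (ghat w - q w) ^ 2 ∂τ ≤ 40 * B ^ 2 + 128 * B ^ 2 * L := by
  obtain ⟨i, hi⟩ := hnet
  have hn0 : (0 : ℝ) < n := by exact_mod_cast hn
  have hn1 : (1 : ℝ) ≤ n := by exact_mod_cast hn
  -- Optimality lets `ghat` replace `q`. Replacing `ghat` by its net point then costs at most `(2/n)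
  -- * 4B` per sample.
  have hsum : ∑ k, excessLoss (g i) q (data k) ≤ 8 * B := by
    calc ∑ k, excessLoss (g i) q (data k)
        = ∑ k, (g i (data k).1 - (data k).2) ^ 2 - ∑ k, (q (data k).1 - (data k).2) ^ 2 := by
          rw [← Finset.sum_sub_distrib]; rfl
      _ ≤ ∑ k, (g i (data k).1 - (data k).2) ^ 2 - ∑ k, (ghat (data k).1 - (data k).2) ^ 2 := by
          linarith
      _ = ∑ k, (g i (data k).1 - ghat (data k).1)
            * (g i (data k).1 + ghat (data k).1 - 2 * (data k).2) := by
          rw [← Finset.sum_sub_distrib]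
          exact Finset.sum_congr rfl fun k _ => by ring
      _ ≤ ∑ _k : Fin n, (2 / n) * (4 * B) := by
          refine Finset.sum_le_sum fun k _ => (le_abs_self _).trans ?_
          rw [abs_mul]
          refine mul_le_mul ?_ ?_ (abs_nonneg _) (by positivity)
          · rw [abs_sub_comm]; exact hi _
          · have b1 := abs_le.1 (hgB i (data k).1)
            have b2 := abs_le.1 (hghB (data k).1)
            have b3 := abs_le.1 (hdata k)
            rw [abs_le]; constructor <;> linarith
      _ = 8 * B := by
          rw [Finset.sum_const, Finset.card_univ, Fintype.card_fin, nsmul_eq_mul]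
          field_simp; norm_num
  have hint : ∀ f : W → ℝ, Measurable f → (∀ w, |f w| ≤ B) →
      Integrable (fun w => (f w - q w) ^ 2) τ := fun f hf hfB => by
    refine integrable_of_abs_le (by fun_prop) (C := (2 * B) ^ 2) (ae_of_all _ fun w => ?_)
    rw [abs_pow]
    refine pow_le_pow_left₀ (abs_nonneg _) ?_ 2
    have := abs_sub (f w) (q w); linarith [hfB w, hqB w]
  have hcmp : ∫ w, (ghat w - q w) ^ 2 ∂τ ≤ 2 * (∫ w, (g i w - q w) ^ 2 ∂τ) + 2 * (2 / n) ^ 2 := by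
    have h1 : ∫ w, (2 * (g i w - q w) ^ 2 + 2 * (2 / n : ℝ) ^ 2) ∂τ
        = 2 * (∫ w, (g i w - q w) ^ 2 ∂τ) + 2 * (2 / n) ^ 2 := by
      rw [integral_add ((hint _ (hg i) (hgB i)).const_mul 2) (integrable_const _),
        integral_const_mul]
      simp
    rw [← h1]
    refine integral_mono (hint _ hgh hghB)
      (((hint _ (hg i) (hgB i)).const_mul 2).add (integrable_const _)) fun w => ?_
    have h2 : (ghat w - g i w) ^ 2 ≤ (2 / n : ℝ) ^ 2 := by
      rw [← sq_abs]; exact pow_le_pow_left₀ (abs_nonneg _) (hi w) 2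
    change (ghat w - q w) ^ 2 ≤ 2 * (g i w - q w) ^ 2 + 2 * (2 / n : ℝ) ^ 2
    nlinarith [sq_nonneg ((ghat w - g i w) - (g i w - q w))]
  have h5 : n * (2 * (2 / n : ℝ) ^ 2) ≤ 8 := by
    have : n * (2 * (2 / n : ℝ) ^ 2) = 8 / n := by field_simp; norm_num
    rw [this]; exact div_le_self (by norm_num) hn1
  have h6 := mul_le_mul_of_nonneg_left hcmp hn0.le
  -- The total is `2 * (16 B + 64 B² L) + 8`, and `32 B + 8 ≤ 40 B²` because `B ≥ 1`.
  nlinarith [hctl i]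

end Regression

/-! ### Variation of a vector-valued measure by Gaussian averaging -/

section Gaussian

theorem integral_abs_gaussianReal : ∫ x, |x| ∂(gaussianReal 0 1) = √(2 / Real.pi) := by
  rw [integral_gaussianReal_eq_integral_smul one_ne_zero]
  have h1 : ∀ x : ℝ, gaussianPDFReal 0 1 x • |x|
      = (√(2 * Real.pi))⁻¹ * (|x| * Real.exp (-(1 / 2) * |x| ^ 2)) := by
    intro x
    simp only [gaussianPDFReal, NNReal.coe_one, mul_one, sub_zero, smul_eq_mul, sq_abs]
    ring_nf
  simp_rw [h1]
  rw [integral_const_mul, integral_comp_abs (f := fun x : ℝ => x * Real.exp (-(1 / 2) * x ^ 2))]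
  have h2 := integral_rpow_mul_exp_neg_mul_rpow (p := 2) (q := 1) (b := 1 / 2) (by norm_num)
    (by norm_num) (by norm_num)
  norm_num at h2
  have h3 : ∫ x in Set.Ioi (0 : ℝ), x * Real.exp (-(1 / 2) * x ^ 2) = 1 := by
    simpa using h2
  rw [h3, mul_one]
  have h4 : √(2 / Real.pi) = 2 / √(2 * Real.pi) := by
    have hpi := Real.pi_pos
    rw [eq_div_iff (by positivity), ← Real.sqrt_mul (by positivity)]
    have : 2 / Real.pi * (2 * Real.pi) = 2 ^ 2 := by field_simp
    rw [this, Real.sqrt_sq (by norm_num)]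
  rw [h4]; ring

variable {d : ℕ}

local notation "𝔼" => EuclideanSpace ℝ (Fin d)

theorem map_inner_stdGaussian {u : 𝔼} (hu : ‖u‖ = 1) :
    (stdGaussian 𝔼).map (fun g => inner ℝ u g) = gaussianReal 0 1 := by
  have h := IsGaussian.map_eq_gaussianReal (μ := stdGaussian 𝔼) (innerSL ℝ u)
  rw [integral_strongDual_stdGaussian, variance_dual_stdGaussian, innerSL_apply_norm, hu] at h
  simpa using h

/-- Every one-dimensional marginal along a unit vector is standard normal. This recovers a norm from
its linear functionals, so that `∫ ‖μ‖` becomes an average of scalar variations. -/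
theorem integral_abs_inner_stdGaussian (v : 𝔼) :
    ∫ g, |inner ℝ v g| ∂(stdGaussian 𝔼) = √(2 / Real.pi) * ‖v‖ := by
  by_cases hv : v = 0
  · simp [hv]
  have hv0 : ‖v‖ ≠ 0 := norm_ne_zero_iff.2 hv
  set u : 𝔼 := ‖v‖⁻¹ • v with hu
  have hu1 : ‖u‖ = 1 := by rw [hu, norm_smul, norm_inv, norm_norm, inv_mul_cancel₀ hv0]
  have hvu : v = ‖v‖ • u := by rw [hu, smul_smul, mul_inv_cancel₀ hv0, one_smul]
  have h1 : ∀ g : 𝔼, |inner ℝ v g| = ‖v‖ * |inner ℝ u g| := fun g => by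
    conv_lhs => rw [hvu]
    rw [real_inner_smul_left, abs_mul, abs_norm]
  simp_rw [h1]
  rw [integral_const_mul, mul_comm]
  congr 1
  rw [← integral_abs_gaussianReal, ← map_inner_stdGaussian hu1, integral_map (by fun_prop)
    (by fun_prop)]

theorem integrable_inner_sq_stdGaussian {u : 𝔼} (hu : ‖u‖ = 1) :
    Integrable (fun g => inner ℝ u g ^ 2) (stdGaussian 𝔼) ∧
      ∫ g, inner ℝ u g ^ 2 ∂(stdGaussian 𝔼) = 1 := by
  have hm : MemLp (fun x : ℝ => x) 2 (gaussianReal 0 1) := memLp_id_gaussianReal 2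
  have hi : Integrable (fun x : ℝ => x ^ 2) (gaussianReal 0 1) := hm.integrable_sq
  have hv : ∫ x : ℝ, x ^ 2 ∂(gaussianReal 0 1) = 1 := by
    have h := variance_fun_id_gaussianReal (μ := 0) (v := 1)
    rw [variance_eq_sub hm] at h
    simpa using h
  constructor
  · rw [← map_inner_stdGaussian hu] at hi
    exact hi.comp_measurable (by fun_prop)
  · rw [← hv, ← map_inner_stdGaussian hu, integral_map (by fun_prop) (by fun_prop)]

theorem integral_le_sqrt_integral_sq {Z : Type*} [MeasurableSpace Z] {ν : Measure Z}
    [IsProbabilityMeasure ν] {f : Z → ℝ} (hf : Integrable f ν)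
    (hf2 : Integrable (fun z => f z ^ 2) ν) : ∫ z, f z ∂ν ≤ √(∫ z, f z ^ 2 ∂ν) := by
  refine Real.le_sqrt_of_sq_le ?_
  set m := ∫ z, f z ∂ν with hm
  have h : 0 ≤ ∫ z, (f z - m) ^ 2 ∂ν := integral_nonneg fun z => sq_nonneg _
  have e : ∀ z, (f z - m) ^ 2 = f z ^ 2 - 2 * m * f z + m ^ 2 := fun z => by ring
  simp_rw [e] at h
  rw [integral_add (by fun_prop) (by fun_prop),
    integral_sub hf2 (hf.const_mul _), integral_const_mul, ← hm] at h
  simp only [integral_const, probReal_univ, one_smul] at h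
  nlinarith

/-- The mean length of the component of a standard Gaussian vector orthogonal to `e`. -/
theorem integral_sqrt_norm_sq_sub_le {e : 𝔼} (he : ‖e‖ = 1) :
    Integrable (fun g => √(‖g‖ ^ 2 - inner ℝ e g ^ 2)) (stdGaussian 𝔼) ∧
      ∫ g, √(‖g‖ ^ 2 - inner ℝ e g ^ 2) ∂(stdGaussian 𝔼) ≤ √(d - 1 : ℝ) := by
  have hb : ∀ i : Fin d, ‖(EuclideanSpace.basisFun (Fin d) ℝ) i‖ = 1 := fun i =>
    (EuclideanSpace.basisFun (Fin d) ℝ).norm_eq_one i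
  have hn : ∀ g : 𝔼, ‖g‖ ^ 2 = ∑ i, inner ℝ (EuclideanSpace.basisFun (Fin d) ℝ i) g ^ 2 :=
    fun g => by
      rw [← (EuclideanSpace.basisFun (Fin d) ℝ).sum_sq_norm_inner_right g]
      simp
  have hni : Integrable (fun g : 𝔼 => ‖g‖ ^ 2) (stdGaussian 𝔼) := by
    simp_rw [hn]
    exact integrable_finsetSum _ fun i _ => (integrable_inner_sq_stdGaussian (hb i)).1
  have hnv : ∫ g : 𝔼, ‖g‖ ^ 2 ∂(stdGaussian 𝔼) = d := by
    simp_rw [hn]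
    rw [integral_finsetSum _ fun i _ => (integrable_inner_sq_stdGaussian (hb i)).1]
    simp_rw [fun i => (integrable_inner_sq_stdGaussian (hb i)).2]
    simp
  obtain ⟨hei, hev⟩ := integrable_inner_sq_stdGaussian he
  have hpos : ∀ g : 𝔼, 0 ≤ ‖g‖ ^ 2 - inner ℝ e g ^ 2 := fun g => by
    have h1 := abs_real_inner_le_norm e g
    rw [he, one_mul] at h1
    have h2 := pow_le_pow_left₀ (abs_nonneg _) h1 2
    rw [sq_abs] at h2
    linarith
  have hsq : ∀ g : 𝔼, √(‖g‖ ^ 2 - inner ℝ e g ^ 2) ^ 2 = ‖g‖ ^ 2 - inner ℝ e g ^ 2 :=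
    fun g => Real.sq_sqrt (hpos g)
  have hi : Integrable (fun g : 𝔼 => √(‖g‖ ^ 2 - inner ℝ e g ^ 2)) (stdGaussian 𝔼) := by
    have hm : MemLp (fun g : 𝔼 => √(‖g‖ ^ 2 - inner ℝ e g ^ 2)) 2 (stdGaussian 𝔼) := by
      rw [memLp_two_iff_integrable_sq (by fun_prop)]
      simp_rw [hsq]
      exact hni.sub hei
    exact hm.integrable (by norm_num)
  refine ⟨hi, ?_⟩
  -- Jensen's inequality; the squared length has mean `d`, of which the direction `e` carries `1`.
  refine (integral_le_sqrt_integral_sq hi ?_).trans (le_of_eq ?_)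
  · simp_rw [hsq]; exact hni.sub hei
  · simp_rw [hsq]; rw [integral_sub hni hei, hnv, hev]

/-- A vector-valued measure whose partial integrals have norm at most `√d`, and which is
non-negative in the direction `φ` of total mass `1`, has a controlled variation on a set of small
`φ`-mass. -/
theorem setIntegral_norm_le_of_density {Y : Type*} [MeasurableSpace Y] {ν : Measure Y}
    [SigmaFinite ν] {μ : Y → 𝔼} (hμ : Measurable μ) (hμi : Integrable μ ν)
    (hμd : ∀ g : Y → ℝ, Measurable g → (∀ y, g y ∈ Set.Icc (0 : ℝ) 1) →
      ‖∫ y, g y • μ y ∂ν‖ ≤ √(d : ℝ))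
    {φ : 𝔼} (hφ : ‖φ‖ ≤ 1) (hpos : ∀ y, 0 ≤ inner ℝ (μ y) φ)
    (hone : ∫ y, inner ℝ (μ y) φ ∂ν = 1) {C : Set Y} (hC : MeasurableSet C) {p : ℝ}
    (hp : ∫ y in C, inner ℝ (μ y) φ ∂ν = p) :
    ∫ y in C, ‖μ y‖ ∂ν ≤ p * √d + √(Real.pi / 2) * (√(d - 1 : ℝ) * (2 * √(d - 1 + p))) := by
  classical
  have hφi : Integrable (fun y => inner ℝ (μ y) φ) ν := hμi.inner_const φ
  have hp0 : 0 ≤ p := hp ▸ integral_nonneg fun y => hpos y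
  have hp1 : p ≤ 1 := by
    rw [← hp, ← hone]
    exact setIntegral_le_integral hφi (ae_of_all _ hpos)
  have hsm : ∀ g : Y → ℝ, Measurable g → (∀ y, |g y| ≤ 2) → Integrable (fun y => g y • μ y) ν :=
    fun g hg hgb => hμi.bdd_smul 2 hg.aestronglyMeasurable (ae_of_all _ hgb)
  have hin : ∀ g : Y → ℝ, Measurable g → (∀ y, |g y| ≤ 2) → ∀ v : 𝔼,
      inner ℝ v (∫ y, g y • μ y ∂ν) = ∫ y, g y * inner ℝ v (μ y) ∂ν := fun g hg hgb v => by
    rw [← integral_inner (hsm g hg hgb)]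
    simp_rw [real_inner_smul_right]
  -- The vector `∫ μ` has norm at most `√d` and pairs with `φ` to `1`, so `φ` cannot be short. This
  -- later bounds a component along `e = φ/‖φ‖` by `√d` times the pairing with `φ`.
  have hφ0 : 1 ≤ √(d : ℝ) * ‖φ‖ := by
    have h1 := hin (fun _ => 1) measurable_const (by norm_num) φ
    simp_rw [one_mul, real_inner_comm _ φ] at h1
    rw [hone] at h1
    have h2 := hμd (fun _ => 1) measurable_const (by simp)
    have h3 := real_inner_le_norm (∫ y, (1 : ℝ) • μ y ∂ν) φ
    rw [h1] at h3
    exact h3.trans (mul_le_mul_of_nonneg_right h2 (norm_nonneg _))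
  have hφp : 0 < ‖φ‖ := by
    rcases (norm_nonneg φ).eq_or_lt with h | h
    · rw [← h, mul_zero] at hφ0; linarith
    · exact h
  obtain ⟨e, hedef⟩ : ∃ e : 𝔼, e = ‖φ‖⁻¹ • φ := ⟨_, rfl⟩
  have he : ‖e‖ = 1 := by rw [hedef, norm_smul, norm_inv, norm_norm, inv_mul_cancel₀ hφp.ne']
  have key : ∀ g : 𝔼, ∫ y in C, |inner ℝ (μ y) g| ∂ν ≤
      |inner ℝ e g| * (p * √d) + √(‖g‖ ^ 2 - inner ℝ e g ^ 2) * (2 * √(d - 1 + p)) := by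
    intro g
    let S : Set Y := {y | 0 ≤ inner ℝ (μ y) g}
    have hS : MeasurableSet S := measurableSet_le measurable_const (by fun_prop)
    -- On `C`, the weights `a` and `b` select the positive and negative parts of `⟨μ, g⟩`, so `a -
    -- b` is its sign there. Both equal `1` off `C`, instead of `0`, so that `a + b = 2 - 1_C` makes
    -- `V + V'` long.
    let a : Y → ℝ := fun y => if y ∈ C then (if y ∈ S then 1 else 0) else 1
    let b : Y → ℝ := fun y => if y ∈ C then (if y ∈ S then 0 else 1) else 1
    have ha : Measurable a := Measurable.ite hC (Measurable.ite hS (by fun_prop) (by fun_prop))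
      (by fun_prop)
    have hb : Measurable b := Measurable.ite hC (Measurable.ite hS (by fun_prop) (by fun_prop))
      (by fun_prop)
    have ha1 : ∀ y, a y ∈ Set.Icc (0 : ℝ) 1 := fun y => by
      simp only [a]; split_ifs <;> simp
    have hb1 : ∀ y, b y ∈ Set.Icc (0 : ℝ) 1 := fun y => by
      simp only [b]; split_ifs <;> simp
    have ha2 : ∀ y, |a y| ≤ 2 := fun y => by
      rw [abs_le]; constructor <;> linarith [(ha1 y).1, (ha1 y).2]
    have hb2 : ∀ y, |b y| ≤ 2 := fun y => by
      rw [abs_le]; constructor <;> linarith [(hb1 y).1, (hb1 y).2]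
    set V := ∫ y, a y • μ y ∂ν with hV
    set V' := ∫ y, b y • μ y ∂ν with hV'
    have hVn : ‖V‖ ≤ √(d : ℝ) := hμd a ha ha1
    have hVn' : ‖V'‖ ≤ √(d : ℝ) := hμd b hb hb1
    have hVin := hin a ha ha2
    have hVin' := hin b hb hb2
    have hai : ∀ v : 𝔼, Integrable (fun y => a y * inner ℝ v (μ y)) ν := fun v => by
      simpa only [real_inner_smul_right] using (hsm a ha ha2).const_inner (𝕜 := ℝ) v
    have hbi : ∀ v : 𝔼, Integrable (fun y => b y * inner ℝ v (μ y)) ν := fun v => by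
      simpa only [real_inner_smul_right] using (hsm b hb hb2).const_inner (𝕜 := ℝ) v
    have hD : ∀ v : 𝔼, inner ℝ v (V - V') = ∫ y in C, (a y - b y) * inner ℝ v (μ y) ∂ν := by
      intro v
      rw [inner_sub_right, hVin, hVin', ← integral_sub (hai v) (hbi v), ← integral_indicator hC]
      refine integral_congr_ae (ae_of_all _ fun y => ?_)
      by_cases hy : y ∈ C <;> simp [a, b, hy, sub_mul]
    have hDg : inner ℝ g (V - V') = ∫ y in C, |inner ℝ (μ y) g| ∂ν := by
      rw [hD]
      refine setIntegral_congr_fun hC fun y hy => ?_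
      by_cases hyS : y ∈ S
      · have : 0 ≤ inner ℝ (μ y) g := hyS
        rw [abs_of_nonneg this, real_inner_comm]
        simp [a, b, hy, hyS]
      · have : inner ℝ (μ y) g < 0 := not_le.1 hyS
        rw [abs_of_neg this, real_inner_comm]
        simp [a, b, hy, hyS]
    have hDφ : |inner ℝ φ (V - V')| ≤ p := by
      rw [hD, ← hp]
      refine (abs_integral_le_integral_abs).trans ?_
      refine integral_mono_of_nonneg (ae_of_all _ fun y => abs_nonneg _) hφi.integrableOn
        (ae_of_all _ fun y => ?_)
      change |(a y - b y) * inner ℝ φ (μ y)| ≤ inner ℝ (μ y) φ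
      rw [abs_mul, real_inner_comm, abs_of_nonneg (hpos y)]
      refine mul_le_of_le_one_left (hpos y) ?_
      rw [abs_le]
      constructor <;> linarith [(ha1 y).1, (ha1 y).2, (hb1 y).1, (hb1 y).2]
    have hDe : |inner ℝ e (V - V')| ≤ p * √d := by
      rw [hedef, real_inner_smul_left, abs_mul, abs_inv, abs_norm, inv_mul_le_iff₀ hφp]
      nlinarith
    have hsum : 2 - p ≤ ‖V + V'‖ := by
      have h1 : inner ℝ φ (V + V') = 2 - p := by
        rw [inner_add_right, hVin, hVin', ← integral_add (hai φ) (hbi φ)]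
        have h2 : ∀ y, a y * inner ℝ φ (μ y) + b y * inner ℝ φ (μ y)
            = 2 * inner ℝ (μ y) φ - C.indicator (fun y => inner ℝ (μ y) φ) y := fun y => by
          rw [real_inner_comm]
          by_cases hy : y ∈ C <;> by_cases hyS : y ∈ S <;> simp [a, b, hy, hyS] <;> ring
        simp_rw [h2]
        rw [integral_sub (hφi.const_mul 2) (hφi.indicator hC), integral_const_mul, hone,
          integral_indicator hC, hp, mul_one]
      rw [← h1]
      refine (real_inner_le_norm _ _).trans ?_
      exact mul_le_of_le_one_left (norm_nonneg _) hφ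
    have hd1 : (1 : ℝ) ≤ d := by
      have h1 : 1 ≤ √(d : ℝ) := by nlinarith [Real.sqrt_nonneg (d : ℝ)]
      exact Real.one_le_sqrt.1 h1
    -- Parallelogram law: `‖V - V'‖² ≤ 4d - (2 - p)² ≤ 4(d - 1 + p)`.
    have hDn : ‖V - V'‖ ≤ 2 * √(d - 1 + p) := by
      have h1 := parallelogram_law_with_norm ℝ V V'
      have h2 : ‖V‖ * ‖V‖ ≤ d := by
        calc _ ≤ √(d : ℝ) * √d := mul_self_le_mul_self (norm_nonneg _) hVn
          _ = d := Real.mul_self_sqrt (by positivity)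
      have h3 : ‖V'‖ * ‖V'‖ ≤ d := by
        calc _ ≤ √(d : ℝ) * √d := mul_self_le_mul_self (norm_nonneg _) hVn'
          _ = d := Real.mul_self_sqrt (by positivity)
      have h4 : ‖V - V'‖ ^ 2 ≤ (2 * √(d - 1 + p)) ^ 2 := by
        rw [mul_pow, Real.sq_sqrt (by linarith)]
        nlinarith [mul_self_le_mul_self (by linarith) hsum, sq_nonneg p]
      exact le_of_sq_le_sq h4 (by positivity)
    -- Along `e` the difference is at most `p √d`, which is small; only the orthogonal part of `g`,
    -- of mean length at most `√(d - 1)`, meets the full length of `V - V'`.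
    have hdec : inner ℝ g (V - V') = inner ℝ e g * inner ℝ e (V - V')
        + inner ℝ (g - inner ℝ e g • e) (V - V') := by
      rw [inner_sub_left, real_inner_smul_left]; ring
    have hPn : ‖g - inner ℝ e g • e‖ = √(‖g‖ ^ 2 - inner ℝ e g ^ 2) := by
      rw [← Real.sqrt_sq (norm_nonneg (g - inner ℝ e g • e)), norm_sub_sq_real, norm_smul, he,
        real_inner_smul_right, real_inner_comm e g, mul_one, Real.norm_eq_abs, sq_abs]
      congr 1; ring
    rw [← hDg, hdec]
    refine add_le_add ?_ ?_
    · refine (le_abs_self _).trans ?_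
      rw [abs_mul]
      exact mul_le_mul_of_nonneg_left hDe (abs_nonneg _)
    · refine (real_inner_le_norm _ _).trans ?_
      rw [hPn]
      exact mul_le_mul_of_nonneg_left hDn (Real.sqrt_nonneg _)
  have hfub : ∫ g, ∫ y in C, |inner ℝ (μ y) g| ∂ν ∂(stdGaussian 𝔼)
      = √(2 / Real.pi) * ∫ y in C, ‖μ y‖ ∂ν := by
    have hprod : Integrable (Function.uncurry fun (g : 𝔼) (y : Y) => |inner ℝ (μ y) g|)
        ((stdGaussian 𝔼).prod (ν.restrict C)) := by
      have h1 : Integrable (fun z : 𝔼 × Y => ‖z.1‖ * ‖μ z.2‖)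
          ((stdGaussian 𝔼).prod (ν.restrict C)) :=
        IsGaussian.integrable_id.norm.mul_prod hμi.integrableOn.norm
      refine h1.mono' ?_ (ae_of_all _ fun z => ?_)
      · exact (by fun_prop : Measurable fun z : 𝔼 × Y => |inner ℝ (μ z.2) z.1|).aestronglyMeasurable
      · simp only [Function.uncurry, Real.norm_eq_abs, abs_abs]
        rw [mul_comm]
        exact abs_real_inner_le_norm _ _
    rw [integral_integral_swap hprod]
    simp_rw [integral_abs_inner_stdGaussian]
    rw [integral_const_mul]
  obtain ⟨hgi, hgv⟩ := integral_sqrt_norm_sq_sub_le he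
  have hei : Integrable (fun g : 𝔼 => |inner ℝ e g|) (stdGaussian 𝔼) :=
    (IsGaussian.integrable_id.const_inner e).abs
  have hfin : √(2 / Real.pi) * ∫ y in C, ‖μ y‖ ∂ν ≤
      √(2 / Real.pi) * (p * √d) + √(d - 1 : ℝ) * (2 * √(d - 1 + p)) := by
    rw [← hfub]
    calc _ ≤ ∫ g : 𝔼, (|inner ℝ e g| * (p * √d)
          + √(‖g‖ ^ 2 - inner ℝ e g ^ 2) * (2 * √(d - 1 + p))) ∂(stdGaussian 𝔼) :=
          integral_mono_of_nonneg (ae_of_all _ fun g => integral_nonneg fun y => abs_nonneg _)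
            ((hei.mul_const _).add (hgi.mul_const _)) (ae_of_all _ key)
      _ = √(2 / Real.pi) * (p * √d)
          + (∫ g : 𝔼, √(‖g‖ ^ 2 - inner ℝ e g ^ 2) ∂(stdGaussian 𝔼)) * (2 * √(d - 1 + p)) := by
          rw [integral_add (hei.mul_const _) (hgi.mul_const _), integral_mul_const,
            integral_mul_const, integral_abs_inner_stdGaussian, he, mul_one]
      _ ≤ _ := by gcongr
  have hinv : √(Real.pi / 2) * √(2 / Real.pi) = 1 := by
    have hpi := Real.pi_pos
    rw [← Real.sqrt_mul (by positivity)]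
    have : Real.pi / 2 * (2 / Real.pi) = 1 := by field_simp
    rw [this, Real.sqrt_one]
  have h := mul_le_mul_of_nonneg_left hfin (Real.sqrt_nonneg (Real.pi / 2))
  rw [mul_add, ← mul_assoc, hinv, ← mul_assoc, hinv, one_mul, one_mul] at h
  exact h

/-- For `p = 0` the hypothesis reads `I ≤ √(2π) (d - 1)`, which is below `d^(3/2)` because `27/4 >
2π`. Since `p ≤ ε I` involves `I` itself, the slack `h/(h - 1)` is what absorbs the terms in `p`. -/
theorem le_of_variation_bound {d h : ℕ} {I p ε : ℝ} (hd : 1 ≤ d) (hh : 2 ≤ h)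
    (hεh : ε * h * (d * √d) ≤ 1) (hI : 0 ≤ I) (hp : p ≤ ε * I)
    (hI' : I ≤ p * √d + √(Real.pi / 2) * (√(d - 1 : ℝ) * (2 * √(d - 1 + p)))) :
    (h - 1) * I ≤ h * (d * √d) := by
  by_contra hc
  rw [not_le] at hc
  have hd' : (1 : ℝ) ≤ d := by exact_mod_cast hd
  have hh' : (2 : ℝ) ≤ h := by exact_mod_cast hh
  have hs : 0 < √(d : ℝ) := Real.sqrt_pos.2 (by linarith)
  have hss : √(d : ℝ) * √d = d := Real.mul_self_sqrt (by positivity)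
  -- In this normalization `p ≤ z`, and the negated goal says `1 < (h - 1) z`.
  set z := I / (h * (d * √d)) with hz
  have hK : 0 < h * (d * √d) := by positivity
  have hIz : I = z * (h * (d * √d)) := by rw [hz]; field_simp
  have hz0 : 0 ≤ z := by positivity
  have hpz : p ≤ z := by
    refine hp.trans ?_
    rw [hIz]
    calc ε * (z * (h * (d * √d))) = z * (ε * h * (d * √d)) := by ring
      _ ≤ z * 1 := by gcongr
      _ = z := mul_one z
  have hz1 : 1 < (h - 1) * z := by
    have : 1 * (h * (d * √d)) < ((h - 1) * z) * (h * (d * √d)) := by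
      rw [hIz] at hc; linarith
    exact lt_of_mul_lt_mul_right this hK.le
  set m : ℝ := d - 1 with hm
  have hm0 : 0 ≤ m := by linarith
  have hR : √(Real.pi / 2) * (√m * (2 * √(m + p))) ≤ √(2 * Real.pi * (m * (m + z))) := by
    have e : √(2 * Real.pi * (m * (m + z))) = √(Real.pi / 2) * (√m * (2 * √(m + z))) := by
      have h1 : 2 * Real.pi * (m * (m + z)) = (Real.pi / 2) * (m * (2 ^ 2 * (m + z))) := by ring
      have hpi := Real.pi_pos
      rw [h1, Real.sqrt_mul (by positivity), Real.sqrt_mul hm0, Real.sqrt_mul (by norm_num),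
        Real.sqrt_sq (by norm_num)]
    rw [e]
    gcongr
  have h1 : √d * (d + m * z) ≤ √(2 * Real.pi * (m * (m + z))) := by
    have h2 : I - z * √d ≤ √(2 * Real.pi * (m * (m + z))) := by
      have : p * √d ≤ z * √d := by gcongr
      linarith
    refine le_trans ?_ h2
    have h3 : I - z * √d = √d * (d * ((h - 1) * z) + m * z) := by rw [hIz, hm]; ring
    rw [h3]
    gcongr
    nlinarith
  have h4 : d * (d + m * z) ^ 2 ≤ 2 * Real.pi * (m * (m + z)) := by
    have hnn : 0 ≤ 2 * Real.pi * (m * (m + z)) := by have := Real.pi_pos; positivity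
    have h5 := mul_self_le_mul_self (by positivity) h1
    rw [Real.mul_self_sqrt hnn] at h5
    calc d * (d + m * z) ^ 2 = (√d * √d) * (d + m * z) ^ 2 := by rw [hss]
      _ = _ := by ring
      _ ≤ _ := h5
  have h6 : 2 * Real.pi * (m * (m + z)) ≤ 6.3 * (m * (m + z)) := by
    have := Real.pi_lt_d2
    gcongr; linarith
  have h7 : d * (d + m * z) ^ 2 ≤ 6.3 * (m * (m + z)) := h4.trans h6
  have hdm : (d : ℝ) = m + 1 := by rw [hm]; ring
  rw [hdm] at h7
  have hmz : 0 ≤ m * z := by positivity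
  rcases Nat.lt_or_ge d 2 with hlt | hge
  · have : m = 0 := by
      have : d = 1 := by omega
      rw [hm, this]; norm_num
    rw [this] at h7; norm_num at h7
  · have hm1 : 1 ≤ m := by
      have : (2 : ℝ) ≤ d := by exact_mod_cast hge
      linarith
    -- With `d = m + 1`, compare powers of `z`: `(m + 1)³ ≥ (27/4) m² > 6.3 m²` for the constant
    -- term, and `2 (m + 1)² ≥ 8 > 6.3` for the coefficient of `m z`.
    nlinarith [mul_nonneg hm0 (sq_nonneg (m - 1.65)), mul_nonneg hmz (sub_nonneg.2 hm1),
      mul_nonneg (mul_nonneg hmz hm0) (sub_nonneg.2 hm1), sq_nonneg (m * z),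
      mul_nonneg hm0 (sq_nonneg (m * z))]

end Gaussian

/-! ### Iterated draws as composition products -/

section Bind

variable {Y Z : Type*} [MeasurableSpace Y] [MeasurableSpace Z]

theorem isProbabilityMeasure_bind {m : Measure Y} [IsProbabilityMeasure m] {f : Y → Measure Z}
    (hf : Measurable f) [∀ y, IsProbabilityMeasure (f y)] : IsProbabilityMeasure (m.bind f) := by
  constructor
  rw [Measure.bind_apply MeasurableSet.univ hf.aemeasurable]
  simp

theorem ae_bind_of_ae {m : Measure Y} {f : Y → Measure Z} (hf : Measurable f) {p : Z → Prop}
    (hp : MeasurableSet {z | p z}) (h : ∀ᵐ y ∂m, ∀ᵐ z ∂(f y), p z) : ∀ᵐ z ∂(m.bind f), p z := by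
  change (m.bind f) {z | p z}ᶜ = 0
  have hm : Measurable fun y => f y {z | p z}ᶜ := (Measure.measurable_coe hp.compl).comp hf
  rw [Measure.bind_apply hp.compl hf.aemeasurable, lintegral_eq_zero_iff hm]
  filter_upwards [h] with y hy
  exact hy

theorem integral_bind_of_ae_abs_le {m : Measure Y} [IsProbabilityMeasure m] {f : Y → Measure Z}
    (hf : Measurable f) [∀ y, IsProbabilityMeasure (f y)] {F : Z → ℝ} (hF : Measurable F) {C : ℝ}
    (hC : ∀ y, ∀ᵐ z ∂(f y), |F z| ≤ C) : ∫ z, F z ∂(m.bind f) = ∫ y, ∫ z, F z ∂(f y) ∂m := by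
  let κ : Kernel Y Z := ⟨f, hf⟩
  have : IsMarkovKernel κ := ⟨fun y => inferInstanceAs (IsProbabilityMeasure (f y))⟩
  have h1 : m.bind f = (m ⊗ₘ κ).map Prod.snd := (Measure.snd_compProd m κ).symm
  rw [h1, integral_map measurable_snd.aemeasurable hF.aestronglyMeasurable]
  refine Measure.integral_compProd (f := fun z : Y × Z => F z.2) (κ := κ) (μ := m)
    (integrable_of_abs_le (hF.comp measurable_snd) (C := C) ?_)
  rw [Measure.ae_compProd_iff (p := fun z : Y × Z => |F z.2| ≤ C)
    (measurableSet_le (by fun_prop) (by fun_prop))]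
  exact ae_of_all _ hC

theorem bind_bind_map_eq {m : Measure Y} [IsProbabilityMeasure m] (κ : Kernel Y Z)
    [IsMarkovKernel κ] (K : Kernel (Y × Z) ℝ) [IsMarkovKernel K] :
    (m.bind fun x => (κ x).bind fun a => (K (x, a)).map fun R => (x, a, R)) =
      ((m ⊗ₘ κ) ⊗ₘ K).map fun p => (p.1.1, p.1.2, p.2) := by
  have hassoc : Measurable fun p : (Y × Z) × ℝ => (p.1.1, p.1.2, p.2) := by fun_prop
  have h1 : Measurable fun p : Y × Z => (K p).map fun R => (p.1, p.2, R) :=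
    measurable_map_param (μ := fun p => K p) K.measurable (f := fun p R => (p.1, p.2, R))
      (by fun_prop)
  have h2 : Measurable fun x : Y => (κ x).bind fun a => (K (x, a)).map fun R => (x, a, R) :=
    measurable_bind_param (μ := fun x => κ x) κ.measurable
      (f := fun x a => (K (x, a)).map fun R => (x, a, R)) h1
  ext s hs
  rw [Measure.bind_apply hs h2.aemeasurable, Measure.map_apply hassoc hs,
    Measure.compProd_apply (hs.preimage hassoc), Measure.lintegral_compProd]
  · refine lintegral_congr fun x => ?_
    have h3 : Measurable fun a => (K (x, a)).map fun R => (x, a, R) :=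
      h1.comp measurable_prodMk_left
    rw [Measure.bind_apply hs h3.aemeasurable]
    refine lintegral_congr fun a => ?_
    rw [Measure.map_apply (by fun_prop) hs]
    rfl
  · exact Kernel.measurable_kernel_prodMk_left (hs.preimage hassoc)

end Bind

variable {X : ℕ → Type*} [∀ t, MeasurableSpace (X t)] {A : Type*} [MeasurableSpace A] {d H : ℕ}

instance (π : Policy X A) (t : ℕ) : IsMarkovKernel (π.ker t) := π.markov t

instance (P : PolicyDist X A) : IsProbabilityMeasure P.law := P.prob

/-! ### State laws, return laws and the Bellman equation -/

namespace MDP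

variable {Θ : Type*} [MeasurableSpace Θ]

theorem measurable_stateLaw_param (M : MDP X A d H) {pol : Θ → Policy X A} {t : ℕ} (ht : t < H)
    (hpol : ∀ ℓ, ℓ < t → Measurable fun p : Θ × X ℓ => (pol p.1).ker ℓ p.2) :
    Measurable fun θ => M.stateLaw (pol θ) t := by
  induction t with
  | zero => exact measurable_const
  | succ t ih =>
    have := M.markov_T t ht
    have hprob : ∀ θ, IsProbabilityMeasure (M.stateLaw (pol θ) t) := fun θ =>
      M.isProbabilityMeasure_stateLaw (pol θ) t (by omega)
    have h1 : Measurable fun p : Θ × X t => ((pol p.1).ker t p.2).bind fun a => M.T t (p.2, a) :=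
      measurable_bind_param (hpol t (by omega)) (f := fun p a => M.T t (p.2, a))
        ((M.T t).measurable.comp (by fun_prop))
    exact measurable_bind_param (ih (by omega) fun ℓ hℓ => hpol ℓ (by omega)) h1

/-- Both claims go through one induction, since measurability of a `bind` uses that its pieces are
probability measures. Only layers strictly after `t` need to depend measurably on the parameter; for
PSDP these are exactly the layers already processed. -/
theorem returnLaw_param_spec (M : MDP X A d H) {pol : Θ → Policy X A} {r : ∀ t, X t → A → ℝ}
    {h : ℕ} (hH : h ≤ H) (hr : ∀ t, t < h → Measurable fun p : X t × A => r t p.1 p.2) (k : ℕ) :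
    ∀ t, t + k < h → (∀ ℓ, t < ℓ → ℓ < h → Measurable fun p : Θ × X ℓ => (pol p.1).ker ℓ p.2) →
      (Measurable fun p : Θ × X t × A => M.returnLaw (pol p.1) r k t p.2.1 p.2.2) ∧
        ∀ θ x a, IsProbabilityMeasure (M.returnLaw (pol θ) r k t x a) := by
  induction k with
  | zero =>
    intro t ht _
    refine ⟨Measure.measurable_dirac.comp ((hr t ht).comp measurable_snd), fun θ x a => ?_⟩
    rw [returnLaw]; infer_instance
  | succ k ih =>
    intro t ht hpol
    have := M.markov_T t (by omega)
    obtain ⟨h1, h2⟩ := ih (t + 1) (by omega) fun ℓ h1 h2 => hpol ℓ (by omega) h2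
    obtain ⟨F, hF⟩ : ∃ F : Θ → X (t + 1) → Measure ℝ, F = fun θ y =>
      ((pol θ).ker (t + 1) y).bind fun b => M.returnLaw (pol θ) r k (t + 1) y b := ⟨_, rfl⟩
    have h3 : Measurable fun p : Θ × X (t + 1) => F p.1 p.2 := by
      rw [hF]
      exact measurable_bind_param (hpol (t + 1) (by omega) (by omega))
        (f := fun p b => M.returnLaw (pol p.1) r k (t + 1) p.2 b)
        (h1.comp (by fun_prop : Measurable fun q : (Θ × X (t + 1)) × A => (q.1.1, q.1.2, q.2)))
    have h3p : ∀ θ y, IsProbabilityMeasure (F θ y) := fun θ y => by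
      have := h2 θ y
      rw [hF]
      exact isProbabilityMeasure_bind
        (h1.comp (by fun_prop : Measurable fun b : A => (θ, y, b)))
    have h4 : Measurable fun p : Θ × X t × A => (M.T t p.2).bind (F p.1) :=
      measurable_bind_param (μ := fun p : Θ × X t × A => M.T t p.2)
        ((M.T t).measurable.comp measurable_snd) (f := fun p y => F p.1 y)
        (h3.comp (by fun_prop : Measurable fun q : (Θ × X t × A) × X (t + 1) => (q.1.1, q.2)))
    have h4p : ∀ p : Θ × X t × A, IsProbabilityMeasure ((M.T t p.2).bind (F p.1)) := fun p => by
      have := h3p p.1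
      exact isProbabilityMeasure_bind (h3.comp measurable_prodMk_left)
    have h5 : ∀ θ x a, M.returnLaw (pol θ) r (k + 1) t x a
        = ((M.T t (x, a)).bind (F θ)).map fun R => r t x a + R := fun θ x a => by
      rw [hF]; rfl
    simp_rw [h5]
    constructor
    · exact measurable_map_param h4 (f := fun p R => r t p.2.1 p.2.2 + R)
        ((((hr t (by omega)).comp measurable_snd).comp measurable_fst).add measurable_snd)
    · intro θ x a
      have := h4p (θ, x, a)
      exact Measure.isProbabilityMeasure_map (by fun_prop)

theorem Q_last (M : MDP X A d H) {r : ∀ t, X t → A → ℝ} {h : ℕ} (π : Policy X A) {t : ℕ}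
    (ht : t + 1 = h) (x : X t) (a : A) :
    M.Q π r h t x a = r t x a := by
  have : h - 1 - t = 0 := by omega
  rw [Q, this, returnLaw, integral_dirac]

section Return

variable (M : MDP X A d H) {r : ∀ t, X t → A → ℝ} {h : ℕ} (hH : h ≤ H)
  (hr : ∀ t, t < h → Measurable fun p : X t × A => r t p.1 p.2)

include hH hr

theorem measurable_returnLaw (π : Policy X A) {k t : ℕ} (hk : t + k < h) :
    Measurable fun p : X t × A => M.returnLaw π r k t p.1 p.2 :=
  (M.returnLaw_param_spec (Θ := Unit) (pol := fun _ => π) hH hr k t hk fun ℓ _ _ =>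
    (π.ker ℓ).measurable.comp measurable_snd).1.comp
      (by fun_prop : Measurable fun p : X t × A => ((), p))

theorem isProbabilityMeasure_returnLaw (π : Policy X A) {k t : ℕ} (hk : t + k < h) (x : X t)
    (a : A) : IsProbabilityMeasure (M.returnLaw π r k t x a) :=
  (M.returnLaw_param_spec (Θ := Unit) (pol := fun _ => π) hH hr k t hk fun ℓ _ _ =>
    (π.ker ℓ).measurable.comp measurable_snd).2 () x a

theorem measurable_bind_returnLaw (π : Policy X A) {k t : ℕ} (hk : t + k < h) :
    Measurable fun y : X t => (π.ker t y).bind fun b => M.returnLaw π r k t y b :=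
  measurable_bind_param (π.ker t).measurable (f := fun y b => M.returnLaw π r k t y b)
    (M.measurable_returnLaw hH hr π hk)

theorem isProbabilityMeasure_bind_returnLaw (π : Policy X A) {k t : ℕ} (hk : t + k < h) (y : X t) :
    IsProbabilityMeasure ((π.ker t y).bind fun b => M.returnLaw π r k t y b) := by
  have := M.isProbabilityMeasure_returnLaw hH hr π hk y
  exact isProbabilityMeasure_bind
    ((M.measurable_returnLaw hH hr π hk).comp measurable_prodMk_left)

theorem ae_abs_returnLaw_le {Bd : ℕ → ℝ} (hBd : ∀ t, t < h → ∀ x a, |r t x a| ≤ Bd t)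
    (π : Policy X A) (k : ℕ) : ∀ t, t + k < h → ∀ x a,
      ∀ᵐ R ∂(M.returnLaw π r k t x a), |R| ≤ ∑ ℓ ∈ Finset.Ico t (t + k + 1), Bd ℓ := by
  induction k with
  | zero =>
    intro t ht x a
    rw [returnLaw, ae_dirac_iff (measurableSet_le (by fun_prop) (by fun_prop))]
    simpa using hBd t ht x a
  | succ k ih =>
    intro t ht x a
    have := M.markov_T t (by omega)
    have hms : ∀ C : ℝ, MeasurableSet {R : ℝ | |R| ≤ C} := fun C =>
      measurableSet_le (by fun_prop) (by fun_prop)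
    rw [returnLaw, ae_map_iff (by fun_prop) (hms _)]
    have h1 : ∀ᵐ R ∂((M.T t (x, a)).bind fun y => (π.ker (t + 1) y).bind fun b =>
        M.returnLaw π r k (t + 1) y b), |R| ≤ ∑ ℓ ∈ Finset.Ico (t + 1) (t + 1 + k + 1), Bd ℓ := by
      refine ae_bind_of_ae (M.measurable_bind_returnLaw hH hr π (by omega)) (hms _)
        (ae_of_all _ fun y => ?_)
      refine ae_bind_of_ae ((M.measurable_returnLaw hH hr π (by omega)).comp
        measurable_prodMk_left) (hms _) (ae_of_all _ fun b => ?_)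
      exact ih (t + 1) (by omega) y b
    filter_upwards [h1] with R hR
    rw [Finset.sum_eq_sum_Ico_succ_bot (by omega : t < t + (k + 1) + 1)]
    refine (abs_add_le _ _).trans (add_le_add (hBd t (by omega) x a) (hR.trans (le_of_eq ?_)))
    congr 2; omega

theorem abs_Q_le {Bd : ℕ → ℝ} (hBd : ∀ t, t < h → ∀ x a, |r t x a| ≤ Bd t)
    (hBd0 : ∀ t, t < h → 0 < Bd t) (π : Policy X A) {t : ℕ} (ht : t < h) (x : X t) (a : A) :
    |M.Q π r h t x a| ≤ ∑ ℓ ∈ Finset.range h, Bd ℓ := by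
  have := M.isProbabilityMeasure_returnLaw hH hr π (by omega : t + (h - 1 - t) < h) x a
  refine (abs_integral_le_of_ae (M.ae_abs_returnLaw_le hH hr hBd π (h - 1 - t) t (by omega)
    x a)).trans ?_
  refine Finset.sum_le_sum_of_subset_of_nonneg (fun ℓ hℓ => ?_) fun ℓ hℓ _ =>
    (hBd0 ℓ (Finset.mem_range.1 hℓ)).le
  have := Finset.mem_Ico.1 hℓ
  exact Finset.mem_range.2 (by omega)

theorem measurable_Q (π : Policy X A) {t : ℕ} (ht : t < h) :
    Measurable fun p : X t × A => M.Q π r h t p.1 p.2 :=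
  measurable_kernel_mean
    ⟨_, M.measurable_returnLaw hH hr π (by omega : t + (h - 1 - t) < h)⟩

/-- The Bellman equation. -/
theorem Q_eq {Bd : ℕ → ℝ} (hBd : ∀ t, t < h → ∀ x a, |r t x a| ≤ Bd t) (π : Policy X A) {t : ℕ}
    (ht : t + 1 < h) (x : X t) (a : A) :
    M.Q π r h t x a
      = r t x a + ∫ y, ∫ b, M.Q π r h (t + 1) y b ∂(π.ker (t + 1) y) ∂(M.T t (x, a)) := by
  have := M.markov_T t (by omega)
  obtain ⟨k, hk⟩ : ∃ k, h - 1 - t = k + 1 := ⟨h - 1 - t - 1, by omega⟩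
  have hk' : h - 1 - (t + 1) = k := by omega
  have hk1 : t + 1 + k < h := by omega
  have hp := M.isProbabilityMeasure_returnLaw hH hr π hk1
  have hp2 := M.isProbabilityMeasure_bind_returnLaw hH hr π hk1
  have hm := M.measurable_bind_returnLaw hH hr π hk1
  have hm1 : ∀ y : X (t + 1), Measurable fun b => M.returnLaw π r k (t + 1) y b := fun y =>
    (M.measurable_returnLaw hH hr π hk1).comp measurable_prodMk_left
  have hpp : IsProbabilityMeasure ((M.T t (x, a)).bind fun y => (π.ker (t + 1) y).bind fun b =>
      M.returnLaw π r k (t + 1) y b) := isProbabilityMeasure_bind hm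
  have hae := M.ae_abs_returnLaw_le hH hr hBd π k (t + 1) hk1
  have hms : ∀ C : ℝ, MeasurableSet {R : ℝ | |R| ≤ C} := fun C =>
    measurableSet_le (by fun_prop) (by fun_prop)
  have hae1 : ∀ y, ∀ᵐ R ∂((π.ker (t + 1) y).bind fun b => M.returnLaw π r k (t + 1) y b),
      |R| ≤ ∑ ℓ ∈ Finset.Ico (t + 1) (t + 1 + k + 1), Bd ℓ := fun y =>
    ae_bind_of_ae (hm1 y) (hms _) (ae_of_all _ fun b => hae y b)
  have hae2 := ae_bind_of_ae hm (hms _) (ae_of_all (M.T t (x, a)) hae1)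
  have hi : Integrable (fun R : ℝ => R) ((M.T t (x, a)).bind fun y =>
      (π.ker (t + 1) y).bind fun b => M.returnLaw π r k (t + 1) y b) :=
    integrable_of_abs_le measurable_id hae2
  rw [Q, hk, returnLaw, integral_map (by fun_prop) (by fun_prop),
    integral_add (integrable_const _) hi]
  congr 1
  · simp
  · rw [integral_bind_of_ae_abs_le (F := fun R => R) hm measurable_id hae1]
    refine integral_congr_ae (ae_of_all _ fun y => ?_)
    change ∫ R, R ∂((π.ker (t + 1) y).bind fun b => M.returnLaw π r k (t + 1) y b) = _
    rw [integral_bind_of_ae_abs_le (F := fun R => R) (hm1 y) measurable_id (hae y)]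
    simp only [Q, hk']

theorem obsLaw_eq (π : Policy X A) {t : ℕ} (ht : t < h) :
    M.obsLaw π r h t = ((M.stateLaw π t ⊗ₘ π.ker t) ⊗ₘ
      ⟨_, M.measurable_returnLaw hH hr π (by omega : t + (h - 1 - t) < h)⟩).map
        fun p => (p.1.1, p.1.2, p.2) := by
  have hp := M.isProbabilityMeasure_returnLaw hH hr π (by omega : t + (h - 1 - t) < h)
  have := M.isProbabilityMeasure_stateLaw π t (by omega)
  let K : Kernel (X t × A) ℝ :=
    ⟨_, M.measurable_returnLaw hH hr π (by omega : t + (h - 1 - t) < h)⟩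
  have : IsMarkovKernel K := ⟨fun p => hp p.1 p.2⟩
  exact bind_bind_map_eq (π.ker t) K

theorem value_eq {Bd : ℕ → ℝ} (hBd : ∀ t, t < h → ∀ x a, |r t x a| ≤ Bd t) (π : Policy X A)
    (h1 : 1 ≤ h) :
    M.value π r h = ∫ x, ∫ a, M.Q π r h 0 x a ∂(π.ker 0 x) ∂(M.stateLaw π 0) := by
  have hp := M.isProbabilityMeasure_returnLaw hH hr π (by omega : 0 + (h - 1 - 0) < h)
  have := M.isProbabilityMeasure_stateLaw π 0 (by omega)
  let K : Kernel (X 0 × A) ℝ :=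
    ⟨_, M.measurable_returnLaw hH hr π (by omega : 0 + (h - 1 - 0) < h)⟩
  have : IsMarkovKernel K := ⟨fun p => hp p.1 p.2⟩
  have hae := M.ae_abs_returnLaw_le hH hr hBd π (h - 1 - 0) 0 (by omega)
  rw [value, M.obsLaw_eq hH hr π (by omega), integral_map (by fun_prop)
    (by fun_prop : Measurable fun z : X 0 × A × ℝ => z.2.2).aestronglyMeasurable]
  have hi : Integrable (fun z : (X 0 × A) × ℝ => z.2) ((M.stateLaw π 0 ⊗ₘ π.ker 0) ⊗ₘ K) := by
    refine integrable_of_abs_le measurable_snd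
      (C := ∑ ℓ ∈ Finset.Ico 0 (0 + (h - 1 - 0) + 1), Bd ℓ) ?_
    rw [Measure.ae_compProd_iff (p := fun z : (X 0 × A) × ℝ => |z.2| ≤ _)
      (measurableSet_le (by fun_prop) (by fun_prop))]
    exact ae_of_all _ fun p => hae p.1 p.2
  refine (Measure.integral_compProd hi).trans ?_
  exact Measure.integral_compProd (f := fun p : X 0 × A => M.Q π r h 0 p.1 p.2)
    (integrable_of_abs_le (M.measurable_Q hH hr π (by omega)) (ae_of_all _ fun p =>
      abs_integral_le_of_ae (hae p.1 p.2)))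

end Return

end MDP

namespace MDP

/-! ### Dependence on the earlier and the later layers of a policy -/

section Congruence

theorem stateLaw_congr (M : MDP X A d H) {π π' : Policy X A} {t : ℕ}
    (hπ : ∀ ℓ, ℓ < t → π.ker ℓ = π'.ker ℓ) : M.stateLaw π t = M.stateLaw π' t := by
  induction t with
  | zero => rfl
  | succ t ih => rw [stateLaw, stateLaw, ih fun ℓ hℓ => hπ ℓ (by omega), hπ t (by omega)]

theorem returnLaw_congr (M : MDP X A d H) {π π' : Policy X A} (r : ∀ t, X t → A → ℝ) (k : ℕ) :
    ∀ t, (∀ ℓ, t < ℓ → π.ker ℓ = π'.ker ℓ) → ∀ x a,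
      M.returnLaw π r k t x a = M.returnLaw π' r k t x a := by
  induction k with
  | zero => intros; rfl
  | succ k ih =>
    intro t hπ x a
    simp only [returnLaw]
    rw [hπ (t + 1) (by omega)]
    simp_rw [ih (t + 1) fun ℓ hℓ => hπ ℓ (by omega)]

end Congruence

/-! ### The performance difference lemma -/

section PerformanceDifference

variable (M : MDP X A d H)

theorem integral_stateLaw_succ (π : Policy X A) {t : ℕ} (ht : t + 1 < H) {F : X (t + 1) → ℝ}
    (hF : Measurable F) {C : ℝ} (hC : ∀ y, |F y| ≤ C) :
    ∫ y, F y ∂(M.stateLaw π (t + 1))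
      = ∫ x, ∫ a, ∫ y, F y ∂(M.T t (x, a)) ∂(π.ker t x) ∂(M.stateLaw π t) := by
  have := M.isProbabilityMeasure_stateLaw π t (by omega)
  have := M.markov_T t ht
  have h1 : Measurable fun x : X t => (π.ker t x).bind fun a => M.T t (x, a) :=
    measurable_bind_param (π.ker t).measurable (f := fun x a => M.T t (x, a)) (M.T t).measurable
  have h2 : ∀ x : X t, Measurable fun a => M.T t (x, a) := fun x =>
    (M.T t).measurable.comp measurable_prodMk_left
  have h3 : ∀ x : X t, IsProbabilityMeasure ((π.ker t x).bind fun a => M.T t (x, a)) := fun x =>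
    isProbabilityMeasure_bind (h2 x)
  rw [stateLaw, integral_bind_of_ae_abs_le h1 hF fun x => ae_of_all _ hC]
  refine integral_congr_ae (ae_of_all _ fun x => ?_)
  exact integral_bind_of_ae_abs_le (h2 x) hF fun a => ae_of_all _ hC

variable {r : ∀ t, X t → A → ℝ} {h : ℕ} (hH : h ≤ H)
  (hr : ∀ t, t < h → Measurable fun p : X t × A => r t p.1 p.2)
  {Bd : ℕ → ℝ} (hBd0 : ∀ t, t < h → 0 < Bd t) (hBd : ∀ t, t < h → ∀ x a, |r t x a| ≤ Bd t)

include hH hr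

theorem measurable_integral_Q (π σ : Policy X A) {t : ℕ} (ht : t < h) :
    Measurable fun x : X t => ∫ a, M.Q π r h t x a ∂(σ.ker t x) :=
  ((M.measurable_Q hH hr π ht).stronglyMeasurable.integral_kernel_prod_right'
    (κ := σ.ker t)).measurable

include hBd0 hBd

theorem abs_integral_Q_le (π σ : Policy X A) {t : ℕ} (ht : t < h) (x : X t) :
    |∫ a, M.Q π r h t x a ∂(σ.ker t x)| ≤ ∑ ℓ ∈ Finset.range h, Bd ℓ :=
  abs_integral_le_of_ae (ae_of_all _ fun a => M.abs_Q_le hH hr hBd hBd0 π ht x a)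

theorem integrable_integral_Q (π σ : Policy X A) {t : ℕ} (ht : t < h) (m : Measure (X t))
    [IsProbabilityMeasure m] :
    Integrable (fun x : X t => ∫ a, M.Q π r h t x a ∂(σ.ker t x)) m :=
  integrable_of_abs_le (M.measurable_integral_Q hH hr π σ ht)
    (ae_of_all _ fun x => M.abs_integral_Q_le hH hr hBd0 hBd π σ ht x)

/-- Telescoping: inserting `Q^σ` averaged over the actions of `π` splits off the advantage in layer
`t`. In the remainder `Q^π - Q^σ` the reward cancels by the Bellman equation, leaving the same
expression one layer later under the law of `π`. -/
theorem integral_Q_sub_eq_sum (π σ : Policy X A) (k : ℕ) : ∀ t, t + k + 1 = h →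
    ∫ x, (∫ a, M.Q π r h t x a ∂(π.ker t x) - ∫ a, M.Q σ r h t x a ∂(σ.ker t x))
      ∂(M.stateLaw π t)
    = ∑ ℓ ∈ Finset.Ico t h, ∫ x, (∫ a, M.Q σ r h ℓ x a ∂(π.ker ℓ x)
        - ∫ a, M.Q σ r h ℓ x a ∂(σ.ker ℓ x)) ∂(M.stateLaw π ℓ) := by
  induction k with
  | zero =>
    intro t ht
    have hI : Finset.Ico t h = {t} := by rw [← ht]; simp
    rw [hI, Finset.sum_singleton]
    simp_rw [M.Q_last _ (show t + 1 = h by omega)]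
  | succ k ih =>
    intro t ht
    have := M.isProbabilityMeasure_stateLaw π t (by omega)
    have := M.markov_T t (by omega)
    rw [Finset.sum_eq_sum_Ico_succ_bot (by omega : t < h), ← ih (t + 1) (by omega)]
    have hi := fun ρ τ : Policy X A =>
      M.integrable_integral_Q hH hr hBd0 hBd ρ τ (by omega : t < h) (M.stateLaw π t)
    have hsplit : ∫ x, (∫ a, M.Q π r h t x a ∂(π.ker t x) - ∫ a, M.Q σ r h t x a ∂(σ.ker t x))
          ∂(M.stateLaw π t)
        = ∫ x, (∫ a, M.Q σ r h t x a ∂(π.ker t x) - ∫ a, M.Q σ r h t x a ∂(σ.ker t x))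
            ∂(M.stateLaw π t)
          + ∫ x, (∫ a, M.Q π r h t x a ∂(π.ker t x) - ∫ a, M.Q σ r h t x a ∂(π.ker t x))
            ∂(M.stateLaw π t) := by
      rw [integral_sub (hi σ π) (hi σ σ), integral_sub (hi π π) (hi σ π),
        integral_sub (hi π π) (hi σ σ)]
      ring
    rw [hsplit]
    congr 1
    have hb := fun (ρ : Policy X A) (y : X (t + 1)) =>
      M.abs_integral_Q_le hH hr hBd0 hBd ρ ρ (by omega : t + 1 < h) y
    have hm := fun ρ : Policy X A => M.measurable_integral_Q hH hr ρ ρ (by omega : t + 1 < h)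
    rw [M.integral_stateLaw_succ π (by omega) (C := 2 * ∑ ℓ ∈ Finset.range h, Bd ℓ)
      (F := fun y => ∫ a, M.Q π r h (t + 1) y a ∂(π.ker (t + 1) y)
        - ∫ a, M.Q σ r h (t + 1) y a ∂(σ.ker (t + 1) y)) ((hm π).sub (hm σ)) fun y => by
        have := abs_sub (∫ a, M.Q π r h (t + 1) y a ∂(π.ker (t + 1) y))
          (∫ a, M.Q σ r h (t + 1) y a ∂(σ.ker (t + 1) y))
        linarith [hb π y, hb σ y]]
    refine integral_congr_ae (ae_of_all _ fun x => ?_)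
    have hQi : ∀ ρ : Policy X A, Integrable (fun a => M.Q ρ r h t x a) (π.ker t x) := fun ρ =>
      integrable_of_abs_le ((M.measurable_Q hH hr ρ (by omega : t < h)).comp measurable_prodMk_left)
      (ae_of_all _ fun a => M.abs_Q_le hH hr hBd hBd0 ρ (by omega : t < h) x a)
    change (∫ a, M.Q π r h t x a ∂(π.ker t x)) - ∫ a, M.Q σ r h t x a ∂(π.ker t x) = _
    rw [← integral_sub (hQi π) (hQi σ)]
    refine integral_congr_ae (ae_of_all _ fun a => ?_)
    have hVi := fun ρ : Policy X A => M.integrable_integral_Q hH hr hBd0 hBd ρ ρ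
      (by omega : t + 1 < h) (M.T t (x, a))
    change M.Q π r h t x a - M.Q σ r h t x a = ∫ y,
      (∫ a, M.Q π r h (t + 1) y a ∂(π.ker (t + 1) y)
        - ∫ a, M.Q σ r h (t + 1) y a ∂(σ.ker (t + 1) y)) ∂(M.T t (x, a))
    rw [M.Q_eq hH hr hBd π (by omega) x a, M.Q_eq hH hr hBd σ (by omega) x a,
      integral_sub (hVi π) (hVi σ)]
    ring

/-- The performance difference lemma. -/
theorem value_sub_value_eq_sum (π σ : Policy X A) (h1 : 1 ≤ h) :
    M.value π r h - M.value σ r h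
      = ∑ t ∈ Finset.range h, ∫ x, (∫ a, M.Q σ r h t x a ∂(π.ker t x)
          - ∫ a, M.Q σ r h t x a ∂(σ.ker t x)) ∂(M.stateLaw π t) := by
  have := M.isProbabilityMeasure_stateLaw π 0 (by omega)
  rw [Finset.range_eq_Ico, ← M.integral_Q_sub_eq_sum hH hr hBd0 hBd π σ (h - 1) 0 (by omega),
    integral_sub (M.integrable_integral_Q hH hr hBd0 hBd π π (by omega) _)
      (M.integrable_integral_Q hH hr hBd0 hBd σ σ (by omega) _),
    M.value_eq hH hr hBd π h1, M.value_eq hH hr hBd σ h1]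
  rfl

end PerformanceDifference

/-! ### The law of one sample -/

section Sample

/-- The law of the state `x_t` when a policy is first drawn from `P`. -/
noncomputable def mixLaw (M : MDP X A d H) (P : PolicyDist X A) (t : ℕ) : Measure (X t) :=
  P.law.bind fun θ => M.stateLaw (P.policy θ) t

variable (M : MDP X A d H) (P : PolicyDist X A)

theorem measurable_stateLaw_policy {t : ℕ} (ht : t < H) :
    Measurable fun θ => M.stateLaw (P.policy θ) t :=
  M.measurable_stateLaw_param ht fun ℓ _ => (P.ker ℓ).measurable

theorem isProbabilityMeasure_mixLaw {t : ℕ} (ht : t < H) :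
    IsProbabilityMeasure (M.mixLaw P t) := by
  have := fun θ => M.isProbabilityMeasure_stateLaw (P.policy θ) t ht
  exact isProbabilityMeasure_bind (M.measurable_stateLaw_policy P ht)

/-- The state law sees only layers before `t` and the return law only layers after `t`, so the
splices separate. The covariate law is thus free of `π`; the learned policy enters only through the
conditional law of the return, as the regression bound requires. -/
theorem sampleLaw_eq [Fintype A] [Nonempty A] {r : ∀ t, X t → A → ℝ} {h : ℕ} (hH : h ≤ H)
    (hr : ∀ t, t < h → Measurable fun p : X t × A => r t p.1 p.2) (π : Policy X A) {t : ℕ}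
    (ht : t < h) {K : Kernel (X t × A) ℝ}
    (hK : ∀ x a, K (x, a) = M.returnLaw π r (h - 1 - t) t x a) :
    M.sampleLaw P π r h t =
      (((M.mixLaw P t).prod (PMF.uniformOfFintype A).toMeasure) ⊗ₘ K).map
        fun p => (p.1.1, p.1.2, p.2) := by
  have := M.isProbabilityMeasure_mixLaw P (by omega : t < H)
  have hp := M.isProbabilityMeasure_returnLaw hH hr π (by omega : t + (h - 1 - t) < h)
  have : IsMarkovKernel K := ⟨fun p => by rw [hK p.1 p.2]; exact hp p.1 p.2⟩
  have hobs : ∀ θ, M.obsLaw (((P.policy θ).splice t (unifPolicy X A)).splice (t + 1) π) r h t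
      = (M.stateLaw (P.policy θ) t).bind fun x => ((PMF.uniformOfFintype A).toMeasure).bind
          fun a => (K (x, a)).map fun R => (x, a, R) := fun θ => by
    have h1 : M.stateLaw (((P.policy θ).splice t (unifPolicy X A)).splice (t + 1) π) t
        = M.stateLaw (P.policy θ) t := M.stateLaw_congr fun ℓ hℓ => by
      simp only [Policy.splice, hℓ, Nat.lt_succ_of_lt hℓ, if_true]
    have h2 : ∀ x, (((P.policy θ).splice t (unifPolicy X A)).splice (t + 1) π).ker t x
        = (PMF.uniformOfFintype A).toMeasure := fun x => by
      simp [Policy.splice, unifPolicy]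
    have h3 : ∀ x a, M.returnLaw (((P.policy θ).splice t (unifPolicy X A)).splice (t + 1) π) r
        (h - 1 - t) t x a = K (x, a) := fun x a => by
      rw [hK]
      refine M.returnLaw_congr r _ t (fun ℓ hℓ => ?_) x a
      simp only [Policy.splice, show ¬ ℓ < t + 1 by omega, if_false]
    simp only [obsLaw, h1, h2, h3]
  have h1 : Measurable fun p : X t × A => (K p).map fun R => (p.1, p.2, R) :=
    measurable_map_param (μ := fun p => K p) K.measurable (f := fun p R => (p.1, p.2, R))
      (by fun_prop)
  have h2 : Measurable fun x : X t => ((PMF.uniformOfFintype A).toMeasure).bind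
      fun a => (K (x, a)).map fun R => (x, a, R) :=
    measurable_bind_param (μ := fun _ : X t => (PMF.uniformOfFintype A).toMeasure)
      measurable_const (f := fun x a => (K (x, a)).map fun R => (x, a, R)) h1
  rw [sampleLaw]
  simp_rw [hobs]
  rw [← Measure.bind_bind (M.measurable_stateLaw_policy P (by omega)).aemeasurable
    h2.aemeasurable, ← Measure.compProd_const]
  change (M.mixLaw P t).bind _ = _
  exact bind_bind_map_eq (Kernel.const _ (PMF.uniformOfFintype A).toMeasure) K

end Sample

/-! ### Policy covers and exceptional sets -/

section Cover

variable (M : MDP X A d H)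

/-- The mean feature vector of `(x_t, a_t)` under `π`. -/
noncomputable def meanFeature (π : Policy X A) (t : ℕ) : EuclideanSpace ℝ (Fin d) :=
  ∫ p, M.φ t p.1 p.2 ∂(M.stateLaw π t ⊗ₘ π.ker t)

theorem integrable_φ {t : ℕ} (ht : t < H) (m : Measure (X t × A)) [IsProbabilityMeasure m] :
    Integrable (fun p : X t × A => M.φ t p.1 p.2) m :=
  Integrable.of_bound (M.measurable_φ t ht).aestronglyMeasurable 1
    (ae_of_all _ fun p => M.norm_φ_le t ht p.1 p.2)

/-- The low-rank structure: a policy enters the next occupancy density linearly, through a single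
vector of norm at most one. -/
theorem occ_succ_eq_inner (π : Policy X A) {t : ℕ} (ht : t < H) (x : X (t + 1)) :
    M.occ π (t + 1) x = inner ℝ (M.μ (t + 1) x) (M.meanFeature π t) := by
  have := M.isProbabilityMeasure_stateLaw π t ht
  have hi := M.integrable_φ ht (M.stateLaw π t ⊗ₘ π.ker t)
  rw [occ, meanFeature, ← integral_inner hi,
    Measure.integral_compProd (hi.const_inner (𝕜 := ℝ) (M.μ (t + 1) x))]

theorem norm_meanFeature_le (π : Policy X A) {t : ℕ} (ht : t < H) : ‖M.meanFeature π t‖ ≤ 1 := by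
  have := M.isProbabilityMeasure_stateLaw π t ht
  simpa [meanFeature] using norm_integral_le_of_norm_le_const (μ := M.stateLaw π t ⊗ₘ π.ker t)
    (ae_of_all _ fun p => M.norm_φ_le t ht p.1 p.2)

theorem occ_succ_nonneg (π : Policy X A) {t : ℕ} (ht : t + 1 < H) (x : X (t + 1)) :
    0 ≤ M.occ π (t + 1) x :=
  integral_nonneg fun y => integral_nonneg fun a => M.density_nonneg t ht y a x

theorem occ_succ_le (π : Policy X A) {t : ℕ} (ht : t < H) (x : X (t + 1)) :
    M.occ π (t + 1) x ≤ ‖M.μ (t + 1) x‖ := by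
  rw [M.occ_succ_eq_inner π ht]
  refine (real_inner_le_norm _ _).trans ?_
  exact mul_le_of_le_one_right (norm_nonneg _) (M.norm_meanFeature_le π ht)

theorem measurable_meanFeature_policy (P : PolicyDist X A) {t : ℕ} (ht : t < H) :
    StronglyMeasurable fun θ => M.meanFeature (P.policy θ) t := by
  have hp := fun θ => M.isProbabilityMeasure_stateLaw (P.policy θ) t ht
  let κ : Kernel P.Θ (X t) := ⟨_, M.measurable_stateLaw_policy P ht⟩
  have : IsMarkovKernel κ := ⟨hp⟩
  have := P.markov t
  have h1 : ∀ θ, M.stateLaw (P.policy θ) t ⊗ₘ (P.policy θ).ker t = (κ ⊗ₖ P.ker t) θ := fun θ =>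
    (Kernel.compProd_apply_eq_compProd_sectR κ (P.ker t) θ).symm
  simp_rw [meanFeature, h1]
  exact (M.measurable_φ t ht).stronglyMeasurable.integral_kernel

/-- The mixture law has density `x ↦ 𝔼_{π ∼ P}[d^π(x)]`. -/
theorem mixLaw_succ_eq_withDensity (P : PolicyDist X A) {t : ℕ} (ht : t + 1 < H) :
    M.mixLaw P (t + 1) = (M.ν (t + 1)).withDensity fun x =>
      ENNReal.ofReal (∫ θ, M.occ (P.policy θ) (t + 1) x ∂P.law) := by
  have := M.sigmaFinite_ν (t + 1) ht
  have hφ := (M.measurable_meanFeature_policy P (by omega : t < H)).measurable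
  have hocc : Measurable fun q : P.Θ × X (t + 1) => M.occ (P.policy q.1) (t + 1) q.2 := by
    simp_rw [M.occ_succ_eq_inner _ (by omega : t < H)]
    exact ((M.measurable_μ (t + 1) ht).comp measurable_snd).inner (hφ.comp measurable_fst)
  ext s hs
  rw [mixLaw, Measure.bind_apply hs (M.measurable_stateLaw_policy P ht).aemeasurable,
    withDensity_apply _ hs]
  simp_rw [fun θ => M.stateLaw_succ_eq_withDensity (P.policy θ) t ht, withDensity_apply _ hs]
  rw [lintegral_lintegral_swap hocc.ennreal_ofReal.aemeasurable]
  refine lintegral_congr fun x => ?_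
  rw [ofReal_integral_eq_lintegral_ofReal]
  · refine integrable_of_abs_le (hocc.comp measurable_prodMk_right) (C := ‖M.μ (t + 1) x‖)
      (ae_of_all _ fun θ => ?_)
    rw [abs_of_nonneg (M.occ_succ_nonneg _ ht x)]
    exact M.occ_succ_le _ (by omega) x
  · exact ae_of_all _ fun θ => M.occ_succ_nonneg _ ht x

theorem integral_occ_eq_inner (P : PolicyDist X A) {t : ℕ} (ht : t < H) (x : X (t + 1)) :
    ∫ θ, M.occ (P.policy θ) (t + 1) x ∂P.law
      = inner ℝ (M.μ (t + 1) x) (∫ θ, M.meanFeature (P.policy θ) t ∂P.law) := by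
  simp_rw [M.occ_succ_eq_inner _ ht]
  refine integral_inner ?_ _
  exact Integrable.of_bound (M.measurable_meanFeature_policy P ht).aestronglyMeasurable 1
    (ae_of_all _ fun θ => M.norm_meanFeature_le _ ht)

/-- Under a policy cover, the law of `x_{t+1}` is dominated by the mixture law outside a set of
small probability. -/
theorem exists_cover_exceptional_set_succ {P : PolicyDist X A} {α ε : ℝ} {t h : ℕ}
    (ht : t + 1 < H) (hcov : M.IsPolicyCover P α ε (t + 1)) (hα : 0 < α) (hε : 0 < ε)
    (hh : 2 ≤ h) (hεh : ε * h * (d * √d) ≤ 1) (π : Policy X A) :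
    ∃ C : Set (X (t + 1)), MeasurableSet C ∧
      (M.stateLaw π (t + 1)).restrict Cᶜ ≤ ENNReal.ofReal α⁻¹ • M.mixLaw P (t + 1) ∧
      (h - 1) * (M.stateLaw π (t + 1)).real C ≤ h * (ε * (d * √d)) := by
  have := M.sigmaFinite_ν (t + 1) ht
  have hprob := M.isProbabilityMeasure_stateLaw π (t + 1) ht
  have hμ := M.measurable_μ (t + 1) ht
  have hocc := fun x => M.occ_succ_eq_inner π (by omega : t < H) x
  have hocc0 := fun x => M.occ_succ_nonneg π ht x
  have hden := M.stateLaw_succ_eq_withDensity π t ht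
  set φ := M.meanFeature π t with hφ
  set φP := ∫ θ, M.meanFeature (P.policy θ) t ∂P.law with hφP
  have hP := fun x => M.integral_occ_eq_inner P (by omega : t < H) x
  have hi : Integrable (fun x => inner ℝ (M.μ (t + 1) x) φ) (M.ν (t + 1)) :=
    (M.integrable_μ (t + 1) ht).inner_const φ
  have hpos : ∀ x, 0 ≤ inner ℝ (M.μ (t + 1) x) φ := fun x => hocc x ▸ hocc0 x
  simp_rw [hocc] at hden
  have hreal : ∀ s, MeasurableSet s →
      (M.stateLaw π (t + 1)).real s = ∫ x in s, inner ℝ (M.μ (t + 1) x) φ ∂(M.ν (t + 1)) := by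
    intro s hs
    rw [integral_eq_lintegral_of_nonneg_ae (ae_of_all _ hpos) hi.integrableOn.aestronglyMeasurable,
      ← withDensity_apply _ hs, ← hden]
    rfl
  have hone : ∫ x, inner ℝ (M.μ (t + 1) x) φ ∂(M.ν (t + 1)) = 1 := by
    rw [← setIntegral_univ, ← hreal _ MeasurableSet.univ, probReal_univ]
  -- The domination is violated exactly on `C`. Comparing with `π` rather than with the supremum
  -- over policies keeps `C` measurable.
  let C : Set (X (t + 1)) :=
    {x | inner ℝ (M.μ (t + 1) x) φP < α * inner ℝ (M.μ (t + 1) x) φ}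
  have hC : MeasurableSet C := measurableSet_lt (by fun_prop) (by fun_prop)
  refine ⟨C, hC, ?_, ?_⟩
  · rw [M.mixLaw_succ_eq_withDensity P ht, hden, Measure.le_iff]
    intro s hs
    rw [Measure.restrict_apply hs, Measure.smul_apply, withDensity_apply _ (hs.inter hC.compl),
      withDensity_apply _ hs, smul_eq_mul, ← lintegral_const_mul' _ _ ENNReal.ofReal_ne_top]
    calc _ ≤ ∫⁻ x in s ∩ Cᶜ, ENNReal.ofReal α⁻¹ *
          ENNReal.ofReal (∫ θ, M.occ (P.policy θ) (t + 1) x ∂P.law) ∂(M.ν (t + 1)) := by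
          refine setLIntegral_mono' (hs.inter hC.compl) fun x hx => ?_
          rw [← ENNReal.ofReal_mul (by positivity)]
          refine ENNReal.ofReal_le_ofReal ?_
          have h1 : α * inner ℝ (M.μ (t + 1) x) φ ≤ inner ℝ (M.μ (t + 1) x) φP := not_lt.1 hx.2
          rw [hP, ← div_eq_inv_mul, le_div_iff₀ hα]
          linarith
      _ ≤ _ := lintegral_mono_set Set.inter_subset_left
  -- In dimension `0` the density would vanish and could not have mass one.
  · have hd : 1 ≤ d := by
      rcases Nat.eq_zero_or_pos d with h0 | h0
      · subst h0
        have : ∀ x, inner ℝ (M.μ (t + 1) x) φ = 0 := fun x => by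
          rw [Subsingleton.elim φ 0, inner_zero_right]
        simp_rw [this] at hone
        simp at hone
      · exact h0
    have hh' : (2 : ℝ) ≤ h := by exact_mod_cast hh
    have hpI : (M.stateLaw π (t + 1)).real C
        ≤ ε * ∫ x in C, ‖M.μ (t + 1) x‖ ∂(M.ν (t + 1)) := by
      rw [hreal C hC, ← integral_const_mul]
      refine setIntegral_mono_on hi.integrableOn
        ((M.integrable_μ (t + 1) ht).norm.const_mul ε).integrableOn hC fun x hx => ?_
      have hx' : inner ℝ (M.μ (t + 1) x) φP < α * inner ℝ (M.μ (t + 1) x) φ := hx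
      have hle : inner ℝ (M.μ (t + 1) x) φ ≤ ⨆ π' : Policy X A, M.occ π' (t + 1) x := by
        rw [← hocc]
        exact le_ciSup (f := fun π' => M.occ π' (t + 1) x)
          ⟨‖M.μ (t + 1) x‖, by rintro _ ⟨π', rfl⟩; exact M.occ_succ_le π' (by omega) x⟩ π
      -- If the density of `π` exceeded `ε ‖μ‖` at a point of `C`, so would the supremum; the cover
      -- property would then apply and contradict membership in `C`.
      by_contra hc
      have h1 := hcov x ((not_le.1 hc).le.trans hle)
      rw [hP] at h1
      have h2 := mul_le_mul_of_nonneg_left hle hα.le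
      linarith
    have hI0 : 0 ≤ ∫ x in C, ‖M.μ (t + 1) x‖ ∂(M.ν (t + 1)) := integral_nonneg fun x => norm_nonneg _
    have hvar := setIntegral_norm_le_of_density hμ (M.integrable_μ (t + 1) ht)
      (M.norm_μ_le (t + 1) ht) (M.norm_meanFeature_le π (by omega : t < H)) hpos hone hC
      (hreal C hC).symm
    have hfin := le_of_variation_bound hd hh hεh hI0 hpI hvar
    calc (h - 1) * (M.stateLaw π (t + 1)).real C
        ≤ (h - 1) * (ε * ∫ x in C, ‖M.μ (t + 1) x‖ ∂(M.ν (t + 1))) :=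
          mul_le_mul_of_nonneg_left hpI (by linarith)
      _ = ε * ((h - 1) * ∫ x in C, ‖M.μ (t + 1) x‖ ∂(M.ν (t + 1))) := by ring
      _ ≤ ε * (h * (d * √d)) := mul_le_mul_of_nonneg_left hfin hε.le
      _ = _ := by ring

end Cover

end MDP

/-! ### Finite nets from covering numbers -/

section Net

variable {A : Type*}

theorem exists_cover_of_coveringNumber_ne_top {S : Type*} {G : Set (S → A → ℝ)} {ε : ℝ}
    (hG : coveringNumber G ε ≠ ⊤) :
    ∃ c : Fin (coveringNumber G ε).toNat → S → A → ℝ, ∀ g ∈ G, ∃ i, ∀ x a, |g x a - c i x a| ≤ ε := by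
  set T : Set ℕ := {N | ∃ c : Fin N → S → A → ℝ, ∀ g ∈ G, ∃ i, ∀ x a, |g x a - c i x a| ≤ ε} with hT
  rcases T.eq_empty_or_nonempty with h0 | h0
  · refine absurd ?_ hG
    refine iInf₂_eq_top.2 fun N hN => ?_
    exact absurd (show N ∈ T from hN) (by rw [h0]; exact Set.notMem_empty N)
  · have hmem : sInf T ∈ T := Nat.sInf_mem h0
    have heq : coveringNumber G ε = (sInf T : ℕ) := by
      refine le_antisymm (iInf₂_le (sInf T) hmem) (le_iInf₂ fun N hN => ?_)
      exact_mod_cast Nat.sInf_le (show N ∈ T from hN)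
    rw [heq, ENat.toNat_natCast]
    exact hmem

/-- The centers of a cover are arbitrary functions, possibly neither measurable nor bounded by `B`.
Moving each useful center to a nearby element of `G` repairs this and doubles the scale. -/
theorem exists_net_of_coveringNumber_ne_top {S : Type*} {G : Set (S → A → ℝ)} {ε : ℝ}
    (hG : coveringNumber G ε ≠ ⊤) (hne : G.Nonempty) :
    ∃ c : Fin (coveringNumber G ε).toNat → S → A → ℝ, (∀ i, c i ∈ G) ∧
      ∀ g ∈ G, ∃ i, ∀ x a, |g x a - c i x a| ≤ 2 * ε := by
  classical
  obtain ⟨c, hc⟩ := exists_cover_of_coveringNumber_ne_top hG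
  obtain ⟨g₀, hg₀⟩ := hne
  let c' : Fin (coveringNumber G ε).toNat → S → A → ℝ := fun i =>
    if hi : ∃ g ∈ G, ∀ x a, |g x a - c i x a| ≤ ε then hi.choose else g₀
  refine ⟨c', fun i => ?_, fun g hg => ?_⟩
  · by_cases hi : ∃ g ∈ G, ∀ x a, |g x a - c i x a| ≤ ε
    · simp only [c', dif_pos hi]; exact hi.choose_spec.1
    · simp only [c', dif_neg hi]; exact hg₀
  · obtain ⟨i, hi⟩ := hc g hg
    have hex : ∃ g ∈ G, ∀ x a, |g x a - c i x a| ≤ ε := ⟨g, hg, hi⟩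
    refine ⟨i, fun x a => ?_⟩
    simp only [c', dif_pos hex]
    have h1 := hex.choose_spec.2 x a
    rw [abs_sub_comm] at h1
    have h2 := abs_sub_le (g x a) (c i x a) (hex.choose x a)
    linarith [hi x a]

theorem one_le_toNat_coveringNumber {S : Type*} {G : Set (S → A → ℝ)} {ε : ℝ}
    (hG : coveringNumber G ε ≠ ⊤) (hne : G.Nonempty) : 1 ≤ (coveringNumber G ε).toNat := by
  obtain ⟨c, hc⟩ := exists_cover_of_coveringNumber_ne_top hG
  obtain ⟨g, hg⟩ := hne
  obtain ⟨i, -⟩ := hc g hg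
  exact i.pos

end Net

namespace MDP

/-! ### Regret of one layer -/

section LayerGap

variable [Fintype A] [Nonempty A] [MeasurableSingletonClass A]

theorem integral_prod_uniform {Y : Type*} [MeasurableSpace Y] {m : Measure Y}
    [IsProbabilityMeasure m] {F : Y × A → ℝ} (hF : Measurable F) {C : ℝ} (hC : ∀ p, |F p| ≤ C) :
    ∫ p, F p ∂(m.prod (PMF.uniformOfFintype A).toMeasure)
      = (Fintype.card A : ℝ)⁻¹ * ∫ x, ∑ a, F (x, a) ∂m := by
  rw [integral_prod _ (integrable_of_abs_le hF (ae_of_all _ hC)), ← integral_const_mul]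
  refine integral_congr_ae (ae_of_all _ fun x => ?_)
  change ∫ a, F (x, a) ∂(PMF.uniformOfFintype A).toMeasure
    = (Fintype.card A : ℝ)⁻¹ * ∑ a, F (x, a)
  rw [PMF.integral_eq_sum, Finset.mul_sum]
  simp

variable (M : MDP X A d H) {r : ∀ t, X t → A → ℝ} {h : ℕ}

/-- One layer of the regret of a policy that is greedy for an estimate `g` of its Q-function. -/
theorem integral_advantage_le (hH : h ≤ H)
    (hr : ∀ t, t < h → Measurable fun p : X t × A => r t p.1 p.2) {Bd : ℕ → ℝ}
    (hBd0 : ∀ t, t < h → 0 < Bd t) (hBd : ∀ t, t < h → ∀ x a, |r t x a| ≤ Bd t)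
    (π σ : Policy X A) {t : ℕ} (ht : t < h) {act : X t → A}
    (hσ : ∀ x, σ.ker t x = Measure.dirac (act x)) {g : X t → A → ℝ}
    (hg : Measurable fun p : X t × A => g p.1 p.2) {B : ℝ} (hgB : ∀ x a, |g x a| ≤ B)
    (hQB : ∀ x a, |M.Q σ r h t x a| ≤ B) (hact : ∀ x a, g x a ≤ g x (act x))
    {P : PolicyDist X A} {α : ℝ} (hα : 0 < α) {C : Set (X t)} (hC : MeasurableSet C)
    (hdom : (M.stateLaw π t).restrict Cᶜ ≤ ENNReal.ofReal α⁻¹ • M.mixLaw P t) :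
    ∫ x, (∫ a, M.Q σ r h t x a ∂(π.ker t x) - ∫ a, M.Q σ r h t x a ∂(σ.ker t x))
        ∂(M.stateLaw π t)
      ≤ 2 * (∑ ℓ ∈ Finset.range h, Bd ℓ) * (M.stateLaw π t).real C
        + √(4 * α⁻¹ * Fintype.card A * ∫ p, (g p.1 p.2 - M.Q σ r h t p.1 p.2) ^ 2
            ∂((M.mixLaw P t).prod (PMF.uniformOfFintype A).toMeasure)) := by
  have := M.isProbabilityMeasure_stateLaw π t (by omega)
  have := M.isProbabilityMeasure_mixLaw P (by omega : t < H)
  set S := ∑ ℓ ∈ Finset.range h, Bd ℓ with hS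
  set adv : X t → ℝ := fun x =>
    ∫ a, M.Q σ r h t x a ∂(π.ker t x) - ∫ a, M.Q σ r h t x a ∂(σ.ker t x) with hadv
  have hQm := M.measurable_Q hH hr σ ht
  have hadvi : Integrable adv (M.stateLaw π t) :=
    (M.integrable_integral_Q hH hr hBd0 hBd σ π ht _).sub
      (M.integrable_integral_Q hH hr hBd0 hBd σ σ ht _)
  have hadvS : ∀ x, adv x ≤ 2 * S := fun x => by
    have h1 := (abs_le.1 (M.abs_integral_Q_le hH hr hBd0 hBd σ π ht x)).2
    have h2 := (abs_le.1 (M.abs_integral_Q_le hH hr hBd0 hBd σ σ ht x)).1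
    simp only [hadv]; linarith
  have hB0 : 0 ≤ B := by
    obtain ⟨x⟩ : Nonempty (X t) := nonempty_of_isProbabilityMeasure (M.stateLaw π t)
    exact (abs_nonneg _).trans (hgB x (Classical.arbitrary A))
  set D : X t → A → ℝ := fun x a => (g x a - M.Q σ r h t x a) ^ 2 with hD
  have hDm : Measurable fun p : X t × A => D p.1 p.2 := (hg.sub hQm).pow_const 2
  have hDB : ∀ x a, |D x a| ≤ (2 * B) ^ 2 := fun x a => by
    rw [hD, abs_pow]
    refine pow_le_pow_left₀ (abs_nonneg _) ?_ 2
    have := abs_sub (g x a) (M.Q σ r h t x a); linarith [hgB x a, hQB x a]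
  have hD0 : ∀ x a, 0 ≤ D x a := fun x a => sq_nonneg _
  set E : X t → ℝ := fun x => ∑ a, D x a with hE
  have hEm : Measurable E :=
    Finset.measurable_sum _ fun a _ => hDm.comp measurable_prodMk_right
  have hE0 : ∀ x, 0 ≤ E x := fun x => Finset.sum_nonneg fun a _ => hD0 x a
  have hEB : ∀ x, |E x| ≤ Fintype.card A * (2 * B) ^ 2 := fun x => by
    refine (Finset.abs_sum_le_sum_abs _ _).trans ?_
    refine (Finset.sum_le_sum fun a _ => hDB x a).trans (le_of_eq ?_)
    simp
  -- Two errors are paid: `Q` to `g` at the compared action, and `g` back to `Q` at the greedy one.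
  -- The sum over actions in `E` dominates the maximum.
  have hadvE : ∀ x, adv x ≤ 2 * √(E x) := fun x => by
    have h1 : ∀ a, |g x a - M.Q σ r h t x a| ≤ √(E x) := fun a => by
      refine Real.abs_le_sqrt ?_
      exact Finset.single_le_sum (f := fun a => D x a) (fun a _ => hD0 x a) (Finset.mem_univ a)
    have h2 : ∀ a, M.Q σ r h t x a ≤ M.Q σ r h t x (act x) + 2 * √(E x) := fun a => by
      have b1 := (abs_le.1 (h1 a)).1
      have b2 := (abs_le.1 (h1 (act x))).2
      linarith [hact x a]
    have h3 : ∫ a, M.Q σ r h t x a ∂(σ.ker t x) = M.Q σ r h t x (act x) := by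
      rw [hσ, integral_dirac]
    have hQi : Integrable (fun a => M.Q σ r h t x a) (π.ker t x) :=
      integrable_of_abs_le (hQm.comp measurable_prodMk_left) (ae_of_all _ fun a => hQB x a)
    have h4 : ∫ a, M.Q σ r h t x a ∂(π.ker t x) ≤ M.Q σ r h t x (act x) + 2 * √(E x) := by
      calc _ ≤ ∫ _, (M.Q σ r h t x (act x) + 2 * √(E x)) ∂(π.ker t x) :=
            integral_mono hQi (integrable_const _) h2
        _ = _ := by simp
    simp only [hadv]
    rw [h3]; linarith
  have hfm : Measurable fun x => 2 * √(E x) := by fun_prop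
  have hf2 : ∀ x, (2 * √(E x)) ^ 2 = 4 * E x := fun x => by
    rw [mul_pow, Real.sq_sqrt (hE0 x)]; norm_num
  have hfi : ∀ m : Measure (X t), IsFiniteMeasure m → Integrable (fun x => 2 * √(E x)) m :=
    fun m _ => by
      refine integrable_of_abs_le hfm (C := 2 * √(Fintype.card A * (2 * B) ^ 2))
        (ae_of_all _ fun x => ?_)
      rw [abs_of_nonneg (by positivity)]
      gcongr
      exact (le_abs_self _).trans (hEB x)
  have hEi : ∀ m : Measure (X t), IsFiniteMeasure m → Integrable (fun x => 4 * E x) m :=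
    fun m _ => (integrable_of_abs_le hEm (ae_of_all _ hEB)).const_mul 4
  have h1 : ∫ x in C, adv x ∂(M.stateLaw π t) ≤ 2 * S * (M.stateLaw π t).real C := by
    calc _ ≤ ∫ _ in C, 2 * S ∂(M.stateLaw π t) :=
          setIntegral_mono_on hadvi.integrableOn (integrable_const _) hC fun x _ => hadvS x
      _ = _ := by simp [mul_comm]
  have h2 : ∫ x in Cᶜ, adv x ∂(M.stateLaw π t) ≤
      √(4 * α⁻¹ * Fintype.card A * ∫ p, D p.1 p.2
        ∂((M.mixLaw P t).prod (PMF.uniformOfFintype A).toMeasure)) := by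
    have hind : ∀ x, (Cᶜ.indicator (fun x => 2 * √(E x)) x) ^ 2
        = Cᶜ.indicator (fun x => 4 * E x) x := fun x => by
      by_cases hx : x ∈ Cᶜ
      · rw [Set.indicator_of_mem hx, Set.indicator_of_mem hx, hf2]
      · rw [Set.indicator_of_notMem hx, Set.indicator_of_notMem hx]; norm_num
    calc ∫ x in Cᶜ, adv x ∂(M.stateLaw π t)
        ≤ ∫ x in Cᶜ, 2 * √(E x) ∂(M.stateLaw π t) :=
          setIntegral_mono_on hadvi.integrableOn (hfi _ inferInstance).integrableOn hC.compl
            fun x _ => hadvE x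
      _ = ∫ x, Cᶜ.indicator (fun x => 2 * √(E x)) x ∂(M.stateLaw π t) :=
          (integral_indicator hC.compl).symm
      _ ≤ √(∫ x, (Cᶜ.indicator (fun x => 2 * √(E x)) x) ^ 2 ∂(M.stateLaw π t)) := by
          refine integral_le_sqrt_integral_sq ((hfi _ inferInstance).indicator hC.compl) ?_
          simp_rw [hind]
          exact (hEi _ inferInstance).indicator hC.compl
      _ = √(∫ x in Cᶜ, 4 * E x ∂(M.stateLaw π t)) := by
          simp_rw [hind]; rw [integral_indicator hC.compl]
      _ ≤ √(4 * α⁻¹ * Fintype.card A * ∫ p, D p.1 p.2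
            ∂((M.mixLaw P t).prod (PMF.uniformOfFintype A).toMeasure)) := by
          refine Real.sqrt_le_sqrt ?_
          have hfin : IsFiniteMeasure (ENNReal.ofReal α⁻¹ • M.mixLaw P t) :=
            Measure.smul_finite _ ENNReal.ofReal_ne_top
          calc ∫ x in Cᶜ, 4 * E x ∂(M.stateLaw π t)
              ≤ ∫ x, 4 * E x ∂(ENNReal.ofReal α⁻¹ • M.mixLaw P t) :=
                integral_mono_measure hdom (ae_of_all _ fun x => by
                  have := hE0 x; simp only [Pi.zero_apply]; positivity) (hEi _ hfin)
            _ = 4 * α⁻¹ * ∫ x, E x ∂(M.mixLaw P t) := by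
                rw [integral_smul_measure, integral_const_mul, ENNReal.toReal_ofReal
                  (by positivity), smul_eq_mul]
                ring
            _ = _ := by
                -- The factor `A` arises here: a sum over actions is `A` times a uniform average.
                rw [integral_prod_uniform hDm fun p => hDB p.1 p.2]
                have : (Fintype.card A : ℝ) ≠ 0 := by exact_mod_cast Fintype.card_ne_zero
                field_simp
                rfl
  rw [← integral_add_compl hC hadvi]
  exact add_le_add h1 h2

end LayerGap

/-! ### Regression error of one layer -/

section LayerRegression

variable [Fintype A] [Nonempty A] (M : MDP X A d H)

/-- The regression error of one layer of PSDP, when the past is recorded by the map `p`. -/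
theorem measure_layer_regression_failure_le {Ω Ω' : Type*} [MeasurableSpace Ω]
    [MeasurableSpace Ω'] {Pr : Measure Ω} [IsProbabilityMeasure Pr] {p : Ω → Ω'}
    (hp : Measurable p) {r : ∀ t, X t → A → ℝ} {h n t : ℕ} (hH : h ≤ H) (hn : 1 ≤ n) (ht : t < h)
    (hr : ∀ t, t < h → Measurable fun p : X t × A => r t p.1 p.2) {pol : Ω' → Policy X A}
    (hpol : ∀ ℓ, t < ℓ → ℓ < h → Measurable fun q : Ω' × X ℓ => (pol q.1).ker ℓ q.2)
    (P : PolicyDist X A) {data : Ω → Fin n → X t × A × ℝ} (hdata : Measurable data)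
    (hlaw : ∀ E, MeasurableSet E → ∀ S, MeasurableSet S → Pr (p ⁻¹' E ∩ data ⁻¹' S) =
      ∫⁻ ω in p ⁻¹' E, Measure.pi (fun _ : Fin n => M.sampleLaw P (pol (p ω)) r h t) S ∂Pr)
    {B : ℝ} (hB : 1 ≤ B)
    (hR : ∀ (π : Policy X A) (x : X t) (a : A),
      ∀ᵐ R ∂(M.returnLaw π r (h - 1 - t) t x a), |R| ≤ B)
    {G : Set (X t → A → ℝ)} (hG : ∀ g ∈ G, Measurable fun p : X t × A => g p.1 p.2)
    (hGB : ∀ g ∈ G, ∀ x a, |g x a| ≤ B) (hreal : ∀ π : Policy X A, M.Q π r h t ∈ G)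
    (hcov : coveringNumber G (1 / n) ≠ ⊤) {ghat : Ω → X t → A → ℝ} (hgh : ∀ ω, ghat ω ∈ G)
    (herm : ∀ ω, ∀ g ∈ G, ∑ i, (ghat ω (data ω i).1 (data ω i).2.1 - (data ω i).2.2) ^ 2 ≤
      ∑ i, (g (data ω i).1 (data ω i).2.1 - (data ω i).2.2) ^ 2) (L : ℝ) :
    Pr {ω | ¬ (n * ∫ q, (ghat ω q.1 q.2 - M.Q (pol (p ω)) r h t q.1 q.2) ^ 2
          ∂((M.mixLaw P t).prod (PMF.uniformOfFintype A).toMeasure)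
        ≤ 40 * B ^ 2 + 128 * B ^ 2 * L)}
      ≤ (coveringNumber G (1 / n)).toNat * ENNReal.ofReal (Real.exp (-L)) := by
  have := M.isProbabilityMeasure_mixLaw P (by omega : t < H)
  obtain ⟨hKm, hKp⟩ := M.returnLaw_param_spec hH hr (pol := pol) (h - 1 - t) t (by omega) hpol
  let K : Kernel (Ω' × X t × A) ℝ := ⟨_, hKm⟩
  have : IsMarkovKernel K := ⟨fun q => hKp q.1 q.2.1 q.2.2⟩
  obtain ⟨c, hcG, hcnet⟩ := exists_net_of_coveringNumber_ne_top hcov ⟨_, hreal (unifPolicy X A)⟩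
  let τ := (M.mixLaw P t).prod (PMF.uniformOfFintype A).toMeasure
  let assoc : (X t × A) × ℝ → X t × A × ℝ := fun z => (z.1.1, z.1.2, z.2)
  have hassoc : Measurable assoc := by fun_prop
  let data' : Ω → Fin n → (X t × A) × ℝ := fun ω k =>
    (((data ω k).1, (data ω k).2.1), (data ω k).2.2)
  let unassoc : (Fin n → X t × A × ℝ) → Fin n → (X t × A) × ℝ := fun z k =>
    (((z k).1, (z k).2.1), (z k).2.2)
  have hun : Measurable unassoc := by fun_prop
  have hdata' : Measurable data' := hun.comp hdata
  have hlaw' : ∀ E, MeasurableSet E → ∀ S, MeasurableSet S → Pr (p ⁻¹' E ∩ data' ⁻¹' S) =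
      ∫⁻ ω in p ⁻¹' E, Measure.pi (fun _ : Fin n => τ ⊗ₘ K.sectR (p ω)) S ∂Pr := by
    intro E hE S hS
    have h1 : data' ⁻¹' S = data ⁻¹' (unassoc ⁻¹' S) := rfl
    rw [h1, hlaw E hE _ (hun hS)]
    refine lintegral_congr fun ω => ?_
    have h2 : M.sampleLaw P (pol (p ω)) r h t = (τ ⊗ₘ K.sectR (p ω)).map assoc :=
      M.sampleLaw_eq P hH hr (pol (p ω)) ht fun x a => by rw [Kernel.sectR_apply]; rfl
    have h3 : IsProbabilityMeasure ((τ ⊗ₘ K.sectR (p ω)).map assoc) :=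
      Measure.isProbabilityMeasure_map hassoc.aemeasurable
    have h4 : Measurable fun (z : Fin n → (X t × A) × ℝ) k => assoc (z k) := by fun_prop
    rw [h2, ← Measure.pi_map_pi (fun _ => hassoc.aemeasurable), Measure.map_apply h4 (hun hS)]
    rfl
  -- The probabilistic bound concerns only the fixed net; passing to `ghat ω` is deterministic for
  -- each `ω`. Hence `ghat` may depend on the data in any way, even non-measurably.
  refine le_trans (measure_mono ?_) (measure_regression_failure_le hp hdata' hlaw' hB
    (fun v => hR (pol v.1) v.2.1 v.2.2) (g := fun i w => c i w.1 w.2) (fun i => hG _ (hcG i))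
    (fun i w => hGB _ (hcG i) w.1 w.2) L)
  intro ω hω hgood
  refine hω (integral_sq_le_of_empirical_le hn (τ := τ) hB (g := fun i w => c i w.1 w.2)
    (q := fun w => M.Q (pol (p ω)) r h t w.1 w.2) (ghat := fun w => ghat ω w.1 w.2)
    (fun i => hG _ (hcG i)) (hG _ (hreal _)) (hG _ (hgh ω)) (fun i w => hGB _ (hcG i) w.1 w.2)
    (fun w => hGB _ (hreal _) w.1 w.2) (fun w => hGB _ (hgh ω) w.1 w.2) (data := data' ω)
    hgood.1 hgood.2 (herm ω _ (hreal _)) ?_)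
  obtain ⟨i, hi⟩ := hcnet _ (hgh ω)
  refine ⟨i, fun w => (hi w.1 w.2).trans (le_of_eq ?_)⟩
  ring

end LayerRegression

end MDP

namespace MDP

variable (M : MDP X A d H)

/-- Under a policy cover, the law of `x_t` is dominated by the mixture law outside a set of small
probability, which is empty in the first layer. -/
theorem exists_cover_exceptional_set {P : PolicyDist X A} {α ε : ℝ} {t h : ℕ} (hH : h ≤ H)
    (ht : t < h) (hcov : M.IsPolicyCover P α ε t) (hα : 0 < α) (hα1 : α < 1) (hε : 0 < ε)
    (hεh : ε * h * (d * √d) ≤ 1) (π : Policy X A) :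
    ∃ C : Set (X t), MeasurableSet C ∧
      (M.stateLaw π t).restrict Cᶜ ≤ ENNReal.ofReal α⁻¹ • M.mixLaw P t ∧
      (M.stateLaw π t).real C ≤ if t = 0 then 0 else h * (ε * (d * √d)) / (h - 1) := by
  cases t with
  | zero =>
    refine ⟨∅, MeasurableSet.empty, ?_, by simp⟩
    -- The initial law is the same for all policies, so domination holds everywhere with constant `1
    -- ≤ α⁻¹`.
    have h1 : M.mixLaw P 0 = M.stateLaw π 0 := by
      have : M.mixLaw P 0 = P.law.bind fun _ => M.ρ := rfl
      rw [this, Measure.bind_const, measure_univ, one_smul]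
      rfl
    rw [h1, Set.compl_empty, Measure.restrict_univ, Measure.le_iff]
    intro s _
    rw [Measure.smul_apply, smul_eq_mul]
    refine le_mul_of_one_le_left (zero_le) ?_
    rw [ENNReal.one_le_ofReal]
    exact (one_le_inv₀ hα).2 hα1.le
  | succ t =>
    obtain ⟨C, hC, h1, h2⟩ := M.exists_cover_exceptional_set_succ (by omega : t + 1 < H) hcov hα hε
      (by omega : 2 ≤ h) hεh π
    refine ⟨C, hC, h1, ?_⟩
    have hh : (2 : ℝ) ≤ h := by exact_mod_cast (by omega : 2 ≤ h)
    rw [if_neg (by omega), le_div_iff₀ (by linarith)]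
    linarith

theorem abs_value_le_of_abs_Q_le {r : ∀ t, X t → A → ℝ} {h : ℕ} (hH : h ≤ H) (h1 : 1 ≤ h)
    (hr : ∀ t, t < h → Measurable fun p : X t × A => r t p.1 p.2)
    {Bd : ℕ → ℝ} (hBd : ∀ t, t < h → ∀ x a, |r t x a| ≤ Bd t) (π : Policy X A) {B : ℝ}
    (hQ : ∀ x a, |M.Q π r h 0 x a| ≤ B) : |M.value π r h| ≤ B := by
  have := M.isProbabilityMeasure_stateLaw π 0 (by omega)
  rw [M.value_eq hH hr hBd π h1]
  exact abs_integral_le_of_ae (ae_of_all _ fun x => abs_integral_le_of_ae (ae_of_all _ (hQ x)))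

end MDP

/-- Only `h - 1` layers have an exceptional set, which cancels the denominator `h - 1`. For `h = 1`
the quotient never occurs. -/
theorem sum_ite_zero_div_le {h : ℕ} {c : ℝ} (hc : 0 ≤ c) (h1 : 1 ≤ h) :
    ∑ t ∈ Finset.range h, (if t = 0 then 0 else c / (h - 1 : ℝ)) ≤ c := by
  obtain ⟨k, rfl⟩ : ∃ k, h = k + 1 := ⟨h - 1, by omega⟩
  rw [Finset.sum_range_succ']
  simp only [Nat.add_eq_zero_iff, one_ne_zero, and_false, if_false, if_true, add_zero,
    Finset.sum_const, Finset.card_range, nsmul_eq_mul, Nat.cast_add, Nat.cast_one,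
    add_sub_cancel_right]
  rcases Nat.eq_zero_or_pos k with h0 | h0
  · simp [h0, hc]
  · have : (k : ℝ) ≠ 0 := by exact_mod_cast h0.ne'
    rw [mul_div_cancel₀ _ this]

/-! ### From single layers to a run of PSDP -/

namespace PSDPRun

variable [Fintype A] [Nonempty A] {M : MDP X A d H} {h : ℕ}
  {r : ∀ t, X t → A → ℝ} {G : ∀ t, Set (X t → A → ℝ)} {P : ℕ → PolicyDist X A} {n : ℕ} {Ω : Type*}
  [mΩ : MeasurableSpace Ω] {Pr : Measure Ω} (run : PSDPRun M h r G P n Pr)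

theorem hist_antitone : Antitone run.hist := antitone_nat_of_succ_le run.hist_succ_le

/-- The regression error of the layer `t` of a run, measured under the law of the samples. -/
noncomputable def regressionError (t : Fin h) (ω : Ω) : ℝ :=
  ∫ q, (run.ghat t ω q.1 q.2 - M.Q (run.output ω) r h t q.1 q.2) ^ 2
    ∂((M.mixLaw (P t) t).prod (PMF.uniformOfFintype A).toMeasure)

theorem measure_regressionError_failure_le [IsProbabilityMeasure Pr] (hH : h ≤ H) (hn : 1 ≤ n)
    (hr : ∀ t, t < h → Measurable fun p : X t × A => r t p.1 p.2) {B : ℝ} (hB : 1 ≤ B)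
    (hG : ∀ t, t < h → ∀ g ∈ G t, Measurable fun p : X t × A => g p.1 p.2)
    (hreal : M.Realizes G r h) (hGB : ∀ t, t < h → ∀ g ∈ G t, ∀ x a, |g x a| ≤ B)
    (hR : ∀ t, t < h → ∀ (π : Policy X A) (x : X t) (a : A),
      ∀ᵐ R ∂(M.returnLaw π r (h - 1 - t) t x a), |R| ≤ B)
    (hcov : ∀ t, t < h → coveringNumber (G t) (1 / n) ≠ ⊤) (t : Fin h) (L : ℝ) :
    Pr {ω | ¬ (n * run.regressionError t ω ≤ 40 * B ^ 2 + 128 * B ^ 2 * L)}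
      ≤ (coveringNumber (G t) (1 / n)).toNat * ENNReal.ofReal (Real.exp (-L)) := by
  have hdata : Measurable (run.data t) := (run.measurable_data t).mono (run.hist_le t) le_rfl
  have hpol : ∀ ℓ, (t : ℕ) < ℓ → ℓ < h →
      @Measurable (Ω × X ℓ) (Measure A) ((run.hist ((t : ℕ) + 1)).prod inferInstance) _
        fun q => (run.output q.1).ker ℓ q.2 := by
    intro ℓ hℓ _
    -- Layers are processed downwards, so the actions in a layer `ℓ ≥ t + 1` are already known to
    -- `hist (t + 1)`.
    have h1 := (run.measurable_act_uncurry ℓ).mono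
      (sup_le_sup (MeasurableSpace.comap_mono (run.hist_antitone (by omega : (t : ℕ) + 1 ≤ ℓ)))
        le_rfl) le_rfl
    have h2 : (fun q : Ω × X ℓ => (run.output q.1).ker ℓ q.2)
        = fun q => Measure.dirac (run.act ℓ q.1 q.2) := by
      funext q
      simp only [output, detPolicy, Kernel.deterministic_apply]
    rw [h2]
    exact Measure.measurable_dirac.comp h1
  -- The past is recorded by the identity map from `Ω` with its full σ-algebra to `Ω` with `hist (t
  -- + 1)`; conditioning on it is conditioning on the history.
  exact @MDP.measure_layer_regression_failure_le X _ A _ d H _ _ M Ω Ω mΩ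
    (run.hist ((t : ℕ) + 1)) Pr _ id (measurable_id'' (run.hist_le _)) r h n t hH hn t.2 hr
    run.output hpol (P t) (run.data t) hdata (run.data_law t) B hB (hR t t.2) (G t) (hG t t.2)
    (hGB t t.2) (hreal t t.2) (hcov t t.2) (run.ghat t) (run.ghat_mem t) (run.ghat_le t) L

/-- The regret of the output of a run whose regression errors are small. -/
theorem value_le_of_regressionError_le [MeasurableSingletonClass A] (hH : h ≤ H) (h1 : 1 ≤ h)
    {α ε B : ℝ} {Bd : ℕ → ℝ} (hα : 0 < α) (hα1 : α < 1) (hε : 0 < ε) (hεh : ε * h * (d * √d) ≤ 1)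
    (hBd0 : ∀ t, t < h → 0 < Bd t)
    (hr : ∀ t, t < h → Measurable fun p : X t × A => r t p.1 p.2)
    (hBd : ∀ t, t < h → ∀ x a, |r t x a| ≤ Bd t)
    (hG : ∀ t, t < h → ∀ g ∈ G t, Measurable fun p : X t × A => g p.1 p.2)
    (hreal : M.Realizes G r h) (hGB : ∀ t, t < h → ∀ g ∈ G t, ∀ x a, |g x a| ≤ B)
    (hcover : ∀ t, t < h → M.IsPolicyCover (P t) α ε t) {ω : Ω} {e : ℝ}
    (he : ∀ t, run.regressionError t ω ≤ e) (π : Policy X A) :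
    M.value π r h ≤ M.value (run.output ω) r h + h * √(4 * α⁻¹ * Fintype.card A * e)
      + 2 * ε * h * (d * √d) * ∑ t ∈ Finset.range h, Bd t := by
  set S := ∑ t ∈ Finset.range h, Bd t with hS
  have hS0 : 0 ≤ S := Finset.sum_nonneg fun t ht => (hBd0 t (Finset.mem_range.1 ht)).le
  have hpd := M.value_sub_value_eq_sum hH hr hBd0 hBd π (run.output ω) h1
  have hterm : ∀ t ∈ Finset.range h, ∫ x, (∫ a, M.Q (run.output ω) r h t x a ∂(π.ker t x)
        - ∫ a, M.Q (run.output ω) r h t x a ∂((run.output ω).ker t x)) ∂(M.stateLaw π t)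
      ≤ 2 * S * (if t = 0 then 0 else h * (ε * (d * √d)) / (h - 1 : ℝ))
        + √(4 * α⁻¹ * Fintype.card A * e) := by
    intro t ht
    have ht' := Finset.mem_range.1 ht
    obtain ⟨C, hC, hdom, hsmall⟩ := M.exists_cover_exceptional_set hH ht' (hcover t ht') hα hα1 hε
      hεh π
    refine (M.integral_advantage_le hH hr hBd0 hBd π (run.output ω) ht' (act := run.act t ω)
      (fun x => Kernel.deterministic_apply (run.measurable_act t ω) x) (hG t ht' _ (run.ghat_mem ⟨t, ht'⟩ ω))
      (hGB t ht' _ (run.ghat_mem ⟨t, ht'⟩ ω)) (hGB t ht' _ (hreal t ht' _))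
      (run.ghat_act ⟨t, ht'⟩ ω) hα hC hdom).trans ?_
    refine add_le_add (mul_le_mul_of_nonneg_left hsmall (by positivity)) (Real.sqrt_le_sqrt ?_)
    exact mul_le_mul_of_nonneg_left (he ⟨t, ht'⟩) (by positivity)
  have hsum := Finset.sum_le_sum hterm
  rw [← hpd, Finset.sum_add_distrib, ← Finset.mul_sum, Finset.sum_const, Finset.card_range,
    nsmul_eq_mul] at hsum
  have hc : 0 ≤ h * (ε * (d * √d)) := by positivity
  have h2 := mul_le_mul_of_nonneg_left (sum_ite_zero_div_le hc h1)
    (by positivity : 0 ≤ 2 * S)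
  calc M.value π r h ≤ M.value (run.output ω) r h + (2 * S * (h * (ε * (d * √d)))
        + h * √(4 * α⁻¹ * Fintype.card A * e)) := by linarith
    _ = _ := by ring

end PSDPRun

theorem rpow_three_halves (d : ℕ) : (d : ℝ) ^ (3 / 2 : ℝ) = d * √d := by
  rw [Real.sqrt_eq_rpow]
  rcases Nat.eq_zero_or_pos d with h | h
  · subst h; norm_num
  · have : (0 : ℝ) < d := by exact_mod_cast h
    rw [show (3 / 2 : ℝ) = 1 + 1 / 2 by norm_num, Real.rpow_add this, Real.rpow_one]

theorem ofReal_one_sub_le_of_compl {Ω : Type*} [MeasurableSpace Ω] {Pr : Measure Ω}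
    [IsProbabilityMeasure Pr] {δ : ℝ} {s : Set Ω} (hδ : 0 ≤ δ)
    (hs : Pr sᶜ ≤ ENNReal.ofReal δ) : ENNReal.ofReal (1 - δ) ≤ Pr s := by
  have h1 : 1 ≤ Pr s + Pr sᶜ := by
    rw [← measure_univ (μ := Pr), ← Set.union_compl_self s]
    exact measure_union_le _ _
  rw [ENNReal.ofReal_sub _ hδ, ENNReal.ofReal_one, tsub_le_iff_right]
  exact h1.trans (by gcongr)

theorem ofReal_one_sub_le_of_forall {Ω : Type*} [MeasurableSpace Ω] {Pr : Measure Ω}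
    [IsProbabilityMeasure Pr] {δ : ℝ} {p : Ω → Prop} (hδ : 0 ≤ δ) (hp : ∀ ω, p ω) :
    ENNReal.ofReal (1 - δ) ≤ Pr {ω | p ω} := by
  have : {ω | p ω} = Set.univ := Set.eq_univ_of_forall hp
  rw [this, measure_univ, ENNReal.ofReal_le_one]
  linarith

end LowRank

open LowRank

/-! ### Trivial regimes, union bound and constants -/

theorem mainTheorem10 :
    ∃ c : ℝ, 0 < c ∧
      ∀ (X : ℕ → Type*) [∀ t, MeasurableSpace (X t)]
        (A : Type*) [Fintype A] [Nonempty A] [MeasurableSpace A] [MeasurableSingletonClass A]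
        (d H : ℕ) (M : LowRank.MDP X A d H)
        (α δ ε B : ℝ) (Bd : ℕ → ℝ) (h n : ℕ)
        (r : ∀ t, X t → A → ℝ) (G : ∀ t, Set (X t → A → ℝ)) (P : ℕ → LowRank.PolicyDist X A)
        (Ω : Type*) [MeasurableSpace Ω] (Pr : Measure Ω) [IsProbabilityMeasure Pr]
        (run : LowRank.PSDPRun M h r G P n Pr),
        0 < α → α < 1 → 0 < δ → δ < 1 → 0 < ε → ε < 1 → 1 ≤ B → 1 ≤ h → h ≤ H →
        1 ≤ n → 2 * δ ≤ n →
        (∀ t, t < h → 0 < Bd t) →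
        (∀ t, t < h → Measurable fun p : X t × A => r t p.1 p.2) →
        (∀ t, t < h → ∀ x a, |r t x a| ≤ Bd t) →
        (∀ t, t < h → ∀ g ∈ G t, Measurable fun p : X t × A => g p.1 p.2) →
        M.Realizes G r h →
        (∀ t, t < h → ∀ g ∈ G t, ∀ x a, |g x a| ≤ B) →
        (∀ t, t < h → ∀ (π : LowRank.Policy X A) (x : X t) (a : A),
          ∀ᵐ R ∂(M.returnLaw π r (h - 1 - t) t x a), |R| ≤ B) →
        (∀ t, t < h → LowRank.coveringNumber (G t) (1 / n) ≠ ⊤) →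
        (∀ t, t < h → M.IsPolicyCover (P t) α ε t) →
        ENNReal.ofReal (1 - δ) ≤ Pr {ω | ∀ π : LowRank.Policy X A,
          M.value π r h ≤ M.value (run.output ω) r h
            + c * H * √(α⁻¹ * B ^ 2 * Fintype.card A * (n : ℝ)⁻¹ *
                ((⨆ t : Fin h, Real.log (LowRank.coveringNumber (G t) (1 / n)).toNat)
                  + Real.log (n / δ)))
            + 2 * ε * h * (d : ℝ) ^ (3 / 2 : ℝ) * ∑ t ∈ Finset.range h, Bd t} := by
  refine ⟨30, by norm_num, ?_⟩
  intro X _ A _ _ _ _ d H M α δ ε B Bd h n r G P Ω _ Pr _ run hα hα1 hδ _ hε _ hB h1 hH hn hnδ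
    hBd0 hr hBd hG hreal hGB hR hcov hcover
  rw [rpow_three_halves]
  have : Nonempty (Fin h) := ⟨⟨0, h1⟩⟩
  have hn0 : (0 : ℝ) < n := by exact_mod_cast hn
  have hH1 : (1 : ℝ) ≤ H := by exact_mod_cast h1.trans hH
  have hhH : (h : ℝ) ≤ H := by exact_mod_cast hH
  have hA : (1 : ℝ) ≤ Fintype.card A := by exact_mod_cast Fintype.card_pos
  set N : Fin h → ℕ := fun t => (coveringNumber (G t) (1 / n)).toNat with hN
  have hN1 : ∀ t, 1 ≤ N t := fun t =>
    one_le_toNat_coveringNumber (hcov t t.2) ⟨_, hreal t t.2 (unifPolicy X A)⟩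
  set Λ : ℝ := (⨆ t : Fin h, Real.log (N t)) + Real.log (n / δ) with hΛ
  have hΛt : ∀ t, Real.log (N t) + Real.log (n / δ) ≤ Λ := fun t =>
    add_le_add (le_ciSup (f := fun t => Real.log (N t)) (Set.finite_range _).bddAbove t) le_rfl
  -- The hypothesis `2 δ ≤ n` serves to keep the logarithmic factor above an absolute constant, here
  -- slightly less than `ln 2`.
  have hlog2 : 0.69 ≤ Real.log (n / δ) := by
    have h2 : (2 : ℝ) ≤ n / δ := by rw [le_div_iff₀ hδ]; linarith
    have := Real.log_le_log (by norm_num) h2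
    linarith [Real.log_two_gt_d9]
  have hΛ69 : 0.69 ≤ Λ := by
    have h2 := hΛt ⟨0, h1⟩
    have h3 : 0 ≤ Real.log (N ⟨0, h1⟩) := Real.log_nonneg (by exact_mod_cast hN1 _)
    linarith
  have hα1' : 1 ≤ α⁻¹ := (one_le_inv₀ hα).2 hα1.le
  have hS0 : 0 ≤ ∑ t ∈ Finset.range h, Bd t :=
    Finset.sum_nonneg fun t ht => (hBd0 t (Finset.mem_range.1 ht)).le
  set S := ∑ t ∈ Finset.range h, Bd t with hS
  set W := α⁻¹ * B ^ 2 * Fintype.card A * (n : ℝ)⁻¹ * Λ with hW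
  -- All values lie in `[-B, B]`, and for `n ≤ H²` the statistical term alone exceeds `2B`.
  by_cases hbig : (n : ℝ) ≤ H ^ 2
  · have hval : ∀ π : Policy X A, |M.value π r h| ≤ B := fun π =>
      M.abs_value_le_of_abs_Q_le hH h1 hr hBd π (hGB 0 h1 _ (hreal 0 h1 π))
    have h2 : 2 * B ≤ 30 * H * √W := by
      have h3 : (B / (2 * H)) ≤ √W := by
        refine Real.le_sqrt_of_sq_le ?_
        have h4 : (B / (2 * H)) ^ 2 = B ^ 2 * (1 / (4 * (H : ℝ) ^ 2)) := by
          field_simp; norm_num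
        have h5 : 1 / (4 * (H : ℝ) ^ 2) ≤ (n : ℝ)⁻¹ * 0.69 := by
          rw [div_le_iff₀ (by positivity), inv_mul_eq_div, div_mul_eq_mul_div, le_div_iff₀ hn0]
          nlinarith
        calc (B / (2 * H)) ^ 2 = B ^ 2 * (1 / (4 * (H : ℝ) ^ 2)) := h4
          _ ≤ B ^ 2 * ((n : ℝ)⁻¹ * 0.69) := by gcongr
          _ ≤ B ^ 2 * ((n : ℝ)⁻¹ * Λ) := by gcongr
          _ = 1 * B ^ 2 * 1 * (n : ℝ)⁻¹ * Λ := by ring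
          _ ≤ W := by rw [hW]; gcongr
      have h6 : 30 * (H : ℝ) * (B / (2 * H)) ≤ 30 * H * √W := by gcongr
      have h7 : 30 * (H : ℝ) * (B / (2 * H)) = 15 * B := by field_simp; norm_num
      linarith
    refine ofReal_one_sub_le_of_forall hδ.le fun ω π => ?_
    have a1 := (abs_le.1 (hval π)).2
    have a2 := (abs_le.1 (hval (run.output ω))).1
    have a3 : 0 ≤ 2 * ε * h * (d * √d) * S := by positivity
    linarith
  -- Otherwise the cover term alone exceeds `2S`, while all values lie in `[-S, S]`.
  by_cases hεh : ε * h * (d * √d) ≤ 1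
  swap
  · have hval : ∀ π : Policy X A, |M.value π r h| ≤ S := fun π =>
      M.abs_value_le_of_abs_Q_le hH h1 hr hBd π (M.abs_Q_le hH hr hBd hBd0 π h1)
    refine ofReal_one_sub_le_of_forall hδ.le fun ω π => ?_
    have a1 := (abs_le.1 (hval π)).2
    have a2 := (abs_le.1 (hval (run.output ω))).1
    have a3 : 0 ≤ 30 * H * √W := by positivity
    have a4 : 2 * S ≤ 2 * ε * h * (d * √d) * S := by
      have := mul_le_mul_of_nonneg_right (not_le.1 hεh).le hS0
      nlinarith
    linarith
  -- From `h ≤ H ≤ H² < n`; this is what pays for the union bound over the layers.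
  have hhn : (h : ℝ) ≤ n := by nlinarith
  refine ofReal_one_sub_le_of_compl hδ.le ?_
  calc _ ≤ Pr (⋃ t : Fin h, {ω | ¬ (n * run.regressionError t ω ≤
          40 * B ^ 2 + 128 * B ^ 2 * (Real.log (N t) + Real.log (n / δ)))}) := by
        refine measure_mono fun ω hω => ?_
        by_contra hc
        rw [Set.mem_iUnion, not_exists] at hc
        refine hω fun π => ?_
        have herr : ∀ t, run.regressionError t ω ≤ 200 * B ^ 2 * (n : ℝ)⁻¹ * Λ := fun t => by
          have h2 := not_not.1 (hc t)
          have h3 : 40 * B ^ 2 + 128 * B ^ 2 * (Real.log (N t) + Real.log (n / δ))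
              ≤ 200 * B ^ 2 * Λ := by
            have h4 : 128 * B ^ 2 * (Real.log (N t) + Real.log (n / δ)) ≤ 128 * B ^ 2 * Λ := by
              gcongr; exact hΛt t
            -- The constant `200` comes from `40 ≤ 72 * 0.69`.
            nlinarith [mul_le_mul_of_nonneg_left hΛ69 (by positivity : 0 ≤ B ^ 2), sq_nonneg B]
          have h5 : run.regressionError t ω ≤ 200 * B ^ 2 * Λ / n := by
            rw [le_div_iff₀ hn0]; linarith
          calc _ ≤ _ := h5
            _ = _ := by rw [div_eq_mul_inv]; ring
        have hmain := run.value_le_of_regressionError_le hH h1 hα hα1 hε hεh hBd0 hr hBd hG hreal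
          hGB hcover herr π
        have h6 : h * √(4 * α⁻¹ * Fintype.card A * (200 * B ^ 2 * (n : ℝ)⁻¹ * Λ))
            ≤ 30 * H * √W := by
          have h7 : √(4 * α⁻¹ * Fintype.card A * (200 * B ^ 2 * (n : ℝ)⁻¹ * Λ)) ≤ 30 * √W := by
            have h8 : 30 * √W = √(30 ^ 2 * W) := by
              rw [Real.sqrt_mul (by norm_num : (0 : ℝ) ≤ 30 ^ 2) W, Real.sqrt_sq (by norm_num)]
            rw [h8]
            refine Real.sqrt_le_sqrt ?_
            have hW0 : 0 ≤ W := by positivity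
            -- Here `c = 30` is fixed, as `800 ≤ 30²`.
            have h9 : 4 * α⁻¹ * Fintype.card A * (200 * B ^ 2 * (n : ℝ)⁻¹ * Λ) = 800 * W := by
              rw [hW]; ring
            rw [h9]; linarith
          calc _ ≤ (H : ℝ) * (30 * √W) := by gcongr
            _ = _ := by ring
        linarith
    _ ≤ ∑ t : Fin h, ENNReal.ofReal (δ / n) := by
        -- Taking `L = ln N + ln (n/δ)` turns the bound `N * exp (-L)` into `δ/n` for each layer.
        refine (measure_iUnion_fintype_le _ _).trans (Finset.sum_le_sum fun t _ => ?_)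
        refine (run.measure_regressionError_failure_le hH hn hr hB hG hreal hGB hR hcov t _).trans
          (le_of_eq ?_)
        have hNt : (0 : ℝ) < N t := by exact_mod_cast hN1 t
        rw [neg_add, Real.exp_add, Real.exp_neg, Real.exp_neg, Real.exp_log hNt,
          Real.exp_log (by positivity), ← ENNReal.ofReal_natCast, ← ENNReal.ofReal_mul (by positivity)]
        congr 1
        change (N t : ℝ) * ((N t : ℝ)⁻¹ * (n / δ)⁻¹) = δ / n
        field_simp
    _ = ENNReal.ofReal (h * (δ / n)) := by
        rw [Finset.sum_const, Finset.card_univ, Fintype.card_fin, nsmul_eq_mul,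
          ENNReal.ofReal_mul (by positivity), ENNReal.ofReal_natCast]
    _ ≤ ENNReal.ofReal δ := by
        refine ENNReal.ofReal_le_ofReal ?_
        rw [mul_div_assoc', div_le_iff₀ hn0]
        nlinarith
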